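/- Links are unoriented links in $S^3$, given by planar diagrams up to planar isotopy and Reidemeister moves, and $\det$ is the determinant of a link. The set $\mathcal Q$ of quasi-alternating links is the smallest set of links that contains the unknot and contains every link $L$ that has a diagram with a crossing $c$ such that both smoothings $L_0$, $L_\infty$ of the diagram at $c$ are in $\mathcal Q$, $\det(L_0),\det(L_\infty)\ge 1$ and $\det(L)=\det(L_0)+\det(L_\infty)$; such a crossing $c$ is called a quasi-alternating crossing of the diagram. A quasi-alternating crossing $c$ has property (I) if switching $c$ gives a diagram of a quasi-alternating link. Draw a crossing $c$ of a diagram $L$ so that its two strands run from bottom to top. Let $L_0$ be obtained by replacing $c$ with two vertical strands, $)($, and $L_\infty$ by replacing $c$ with two horizontal arcs, $\asymp$. Let $L^{\bar n}$ (respectively $L^{-\bar n}$) be obtained from $L$ by replacing $c$ with $n$ copies of the switched crossing stacked vertically (respectively placed side by side horizontally), that is, with $n$ vertical (respectively horizontal) half twists of the type opposite to $c$. Let $c$ be a quasi-alternating crossing of a link diagram $L$ such that $c$ has property (I), and let $n>1$. (1) If $\det(L_0)<\det(L_\infty)$, then $L^{\bar n}$ is quasi-alternating, and each of the $n$ new crossings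 of $L^{\bar n}$ is a quasi-alternating crossing. (2) If $\det(L_0)>\det(L_\infty)$, then $L^{-\bar n}$ is quasi-alternating, and each of the $n$ new crossings of $L^{-\bar n}$ is a quasi-alternating crossing. -/

import Mathlib

/-!
Unoriented link diagrams in Morse position. After a planar isotopy every link diagram in the plane
is cut by horizontal lines into slices, each of which holds vertical strands and exactly one of
the following: a local minimum (`cup`), a local maximum (`cap`), or an upright crossing. A diagram
is the list of its slices, read from bottom to top.
-/

namespace QALink

/-- The three elementary pictures. In `cross s` two neighbouring strands cross. If `s = true` the
strand that runs from the bottom left to the top right is the over-strand; if `s = false` it is the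
strand that runs from the bottom right to the top left. -/
inductive Kind
  | cup
  | cap
  | cross (s : Bool)

/-- Number of strands that enter an elementary picture from below. -/
def Kind.inputs : Kind → ℕ
  | .cup => 0
  | .cap => 2
  | .cross _ => 2

/-- Number of strands that leave an elementary picture at its top. -/
def Kind.outputs : Kind → ℕ
  | .cup => 2
  | .cap => 0
  | .cross _ => 2

/-- A slice: an elementary picture with exactly `pos` vertical strands on its left (and any number
of vertical strands on its right). -/
structure Slice where
  kind : Kind
  pos : ℕ

abbrev cup (i : ℕ) : Slice := ⟨.cup, i⟩
abbrev cap (i : ℕ) : Slice := ⟨.cap, i⟩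
abbrev cross (s : Bool) (i : ℕ) : Slice := ⟨.cross s, i⟩

/-- Slices stacked from bottom to top. -/
abbrev Word := List Slice

/-- The number of strands above a slice that has `m` strands below it, if the slice fits. -/
def Slice.apply (e : Slice) (m : ℕ) : Option ℕ :=
  if e.pos + e.kind.inputs ≤ m then some (m - e.kind.inputs + e.kind.outputs) else none

/-- The number of strands at the top of a stack of slices that starts with `m` strands
(`none` if the slices do not fit together). -/
def strandsAbove : ℕ → Word → Option ℕ
  | m, [] => some m
  | m, e :: w => (e.apply m).bind fun m' => strandsAbove m' w

/-- A link diagram: the slices fit together, and there are no loose ends at the bottom or top. -/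
def IsLinkDiagram (w : Word) : Prop := strandsAbove 0 w = some 0

/-! ### Equivalence of diagrams -/

/-- The local moves: planar isotopies (exchange of the heights of two pictures that lie side by
side, cancellation of a minimum against a neighbouring maximum, and moving a strand across a
maximum or minimum) and the three Reidemeister moves. -/
inductive LocalMove : Word → Word → Prop
  | exchange (k l : Kind) (i j : ℕ) (h : i ≤ j) :
      LocalMove [⟨k, i⟩, ⟨l, j + k.outputs⟩] [⟨l, j + k.inputs⟩, ⟨k, i⟩]
  | zigzag_left (i : ℕ) : LocalMove [cup (i + 1), cap i] []
  | zigzag_right (i : ℕ) : LocalMove [cup i, cap (i + 1)] []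
  | slide_cap (s : Bool) (i : ℕ) :
      LocalMove [cross s i, cap (i + 1)] [cross (!s) (i + 1), cap i]
  | slide_cup (s : Bool) (i : ℕ) :
      LocalMove [cup (i + 1), cross s i] [cup i, cross (!s) (i + 1)]
  | reidemeister_one_cap (s : Bool) (i : ℕ) : LocalMove [cross s i, cap i] [cap i]
  | reidemeister_one_cup (s : Bool) (i : ℕ) : LocalMove [cup i, cross s i] [cup i]
  | reidemeister_two (s : Bool) (i : ℕ) : LocalMove [cross s i, cross (!s) i] []
  | reidemeister_three (s : Bool) (i : ℕ) :
      LocalMove [cross s i, cross s (i + 1), cross s i]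
        [cross s (i + 1), cross s i, cross s (i + 1)]

/-- Two link diagrams that differ by one local move. -/
def DiagramStep (w w' : Word) : Prop :=
  IsLinkDiagram w ∧ IsLinkDiagram w' ∧
    ∃ u v a b : Word, LocalMove a b ∧ w = u ++ a ++ v ∧ w' = u ++ b ++ v

/-- Equivalence of link diagrams: they are diagrams of the same (unoriented) link. -/
def DiagramEquiv : Word → Word → Prop := Relation.EqvGen DiagramStep

/-! ### The determinant -/

/-- The end points of the strands in one slice: the `j`-th one at the bottom or at the top. -/
inductive End
  | bot (j : ℕ)
  | top (j : ℕ)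

/-- The pairs of end points that are joined by a strand within a slice. -/
inductive Slice.Strand : Slice → End → End → Prop
  | left (k : Kind) (i j : ℕ) (h : j < i) : Strand ⟨k, i⟩ (.bot j) (.top j)
  | right (k : Kind) (i j : ℕ) (h : i ≤ j) :
      Strand ⟨k, i⟩ (.bot (j + k.inputs)) (.top (j + k.outputs))
  | cup (i : ℕ) : Strand (cup i) (.top i) (.top (i + 1))
  | cap (i : ℕ) : Strand (cap i) (.bot i) (.bot (i + 1))
  | cross_up (s : Bool) (i : ℕ) : Strand (cross s i) (.bot i) (.top (i + 1))
  | cross_down (s : Bool) (i : ℕ) : Strand (cross s i) (.bot (i + 1)) (.top i)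

/-- The points in which a diagram meets the horizontal lines between its slices: `(k, j)` is the
`j`-th point on the line above the first `k` slices. -/
def Point (w : Word) : Type :=
  {x : ℕ × ℕ // x.1 ≤ w.length ∧ ∃ m, strandsAbove 0 (w.take x.1) = some m ∧ x.2 < m}

/-- The position in the diagram of an end point of the slice with index `k`. -/
def End.place (k : ℕ) : End → ℕ × ℕ
  | .bot j => (k, j)
  | .top j => (k + 1, j)

/-- Two points that are joined by a strand within one slice. -/
def Joined (w : Word) (x y : Point w) : Prop :=
  ∃ (k : ℕ) (e : Slice) (a b : End),
    w[k]? = some e ∧ e.Strand a b ∧ x.1 = a.place k ∧ y.1 = b.place k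

/-- The number of closed curves of a diagram. -/
noncomputable def circles (w : Word) : ℕ := Nat.card (Quot (Joined w))

/-- The Kauffman states of a diagram: every crossing is replaced by one of its two smoothings, two
vertical strands or a maximum below a minimum. A state is listed together with the number of
its A-smoothings minus the number of its B-smoothings. The A-smoothing joins the two regions that
the over-strand sweeps out when it is turned counterclockwise. -/
def states : Word → List (ℤ × Word)
  | [] => [(0, [])]
  | ⟨.cup, i⟩ :: w => (states w).map fun x => (x.1, cup i :: x.2)
  | ⟨.cap, i⟩ :: w => (states w).map fun x => (x.1, cap i :: x.2)
  | ⟨.cross s, i⟩ :: w =>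
      (states w).map (fun x => (x.1 + (if s then 1 else -1), x.2)) ++
        (states w).map (fun x => (x.1 - (if s then 1 else -1), cap i :: cup i :: x.2))

/-- The Kauffman bracket, normalised to be `1` on the circle, as a function of `A`. -/
noncomputable def bracket (A : ℂ) (w : Word) : ℂ :=
  ((states w).map fun x => A ^ x.1 * (-A ^ 2 - (A ^ 2)⁻¹) ^ (circles x.2 - 1)).sum

/-- The determinant of a link, `|V(-1)|` for the Jones polynomial `V`. Since `V(t)` is the Kauffman
bracket at `t = A⁻⁴` up to a power of `-A`, this is the modulus of the bracket at `A = exp(πi/4)`. -/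
noncomputable def det (w : Word) : ℝ :=
  ‖bracket (Complex.exp (Real.pi * Complex.I / 4)) w‖

/-! ### Crossings and quasi-alternating links -/

/-- A stack of slices with a distinguished crossing: the slices below it, its position and its
sign, and the slices above it. -/
structure MarkedCrossing where
  below : Word
  sign : Bool
  pos : ℕ
  above : Word

namespace MarkedCrossing

/-- Replace the distinguished crossing by the tangle `T`, which has two strands at the bottom and
two at the top and is already shifted to the position of the crossing. -/
def replace (c : MarkedCrossing) (T : Word) : Word := c.below ++ T ++ c.above

/-- The diagram `L` that contains the crossing. -/
def diagram (c : MarkedCrossing) : Word := c.replace [cross c.sign c.pos]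

/-- `L_0`: the crossing is replaced by two vertical strands. -/
def smoothZero (c : MarkedCrossing) : Word := c.replace []

/-- `L_∞`: the crossing is replaced by a maximum below a minimum. -/
def smoothInfty (c : MarkedCrossing) : Word := c.replace [cap c.pos, cup c.pos]

/-- The diagram with the crossing switched. -/
def switched (c : MarkedCrossing) : Word := c.replace [cross (!c.sign) c.pos]

/-- The determinant property of a crossing. -/
def DeterminantProperty (c : MarkedCrossing) : Prop :=
  1 ≤ det c.smoothZero ∧ 1 ≤ det c.smoothInfty ∧
    det c.diagram = det c.smoothZero + det c.smoothInfty

end MarkedCrossing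

/-- Diagrams of quasi-alternating links: the smallest class of link diagrams, closed under
equivalence, that contains the unknot and every diagram with a crossing that has the determinant
property and both of whose smoothings belong to the class. -/
inductive QuasiAlternating : Word → Prop
  | unknot : QuasiAlternating [cup 0, cap 0]
  | equiv (w w' : Word) (h : DiagramEquiv w w') (hw : QuasiAlternating w) : QuasiAlternating w'
  | crossing (c : MarkedCrossing) (hd : IsLinkDiagram c.diagram)
      (h0 : QuasiAlternating c.smoothZero) (h1 : QuasiAlternating c.smoothInfty)
      (h : c.DeterminantProperty) : QuasiAlternating c.diagram

namespace MarkedCrossing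

/-- The crossing is a quasi-alternating crossing of the link diagram that contains it. -/
def IsQuasiAlternating (c : MarkedCrossing) : Prop :=
  IsLinkDiagram c.diagram ∧ QuasiAlternating c.smoothZero ∧ QuasiAlternating c.smoothInfty ∧
    c.DeterminantProperty

/-- Property (I): switching the crossing gives a diagram of a quasi-alternating link. -/
def PropertyI (c : MarkedCrossing) : Prop := QuasiAlternating c.switched

end MarkedCrossing

/-- `n` vertical half twists: `n` crossings of sign `s` on top of each other. -/
def verticalTwists (n : ℕ) (s : Bool) (i : ℕ) : Word := List.replicate n (cross s i)

/-- `n ≥ 1` horizontal half twists: `n` crossings of sign `s` side by side at the positions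
`i, i + 2, …, i + 2 (n - 1)`, where the two right ends of each are joined to the two left ends of
the next one by a minimum and a maximum. (For `n = 0` there is no crossing, and this is not used.) -/
def horizontalTwists (n : ℕ) (s : Bool) (i : ℕ) : Word :=
  (List.range (n - 1)).map (fun k => cup (i + 1 + 2 * k)) ++
    (List.range n).map (fun k => cross s (i + 2 * k)) ++
    List.replicate (n - 1) (cap (i + 1))

namespace MarkedCrossing

/-- `n` vertical half twists of the type opposite to the crossing, in place of the crossing. -/
def verticalOppositeTwists (c : MarkedCrossing) (n : ℕ) : Word :=
  verticalTwists n (!c.sign) c.pos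

/-- `n` horizontal half twists of the type opposite to the crossing, in place of the crossing. -/
def horizontalOppositeTwists (c : MarkedCrossing) (n : ℕ) : Word :=
  horizontalTwists n (!c.sign) c.pos

/-- `c'` is one of the crossings of `T` in the diagram obtained by putting `T` in place of `c`. -/
def IsNewCrossing (c : MarkedCrossing) (T : Word) (c' : MarkedCrossing) : Prop :=
  ∃ p q : Word, T = p ++ [cross c'.sign c'.pos] ++ q ∧
    c'.below = c.below ++ p ∧ c'.above = q ++ c.above

end MarkedCrossing

end QALink

/-! Let `x` and `y` be the brackets of `L_0` and `L_∞` at an eighth root of unity `ζ`, and let `z`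
be `ζ` or `ζ⁻¹`, the weight of the vertical smoothing of the switched crossing. The bracket of `L`
is `z⁻¹x + zy`, so `det L = det L_0 + det L_∞` is equality in the triangle inequality: `y` is a
positive multiple of `z⁻²x` (`eq_of_norm_add`). A closed curve has value `0` at `ζ`, so `n` opposite
vertical twists have bracket `zⁿx + n zⁿ⁻²y`, and `n` horizontal ones have `n z²⁻ⁿx + z⁻ⁿy`. As `z⁴
= -1`, the two terms now point in opposite directions, and the determinants are `|det L_0 - n det
L_∞|` and `|n det L_0 - det L_∞|` (`det_stack`, `det_row`).

Both parts follow by induction on the number of twists, with property (I) as the case of one twist.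
Resolving any crossing of `n + 1` vertical twists gives `n` vertical twists, or a diagram that
untwists to `L_∞` by Reidemeister I (`red_stack_infty`). For horizontal twists the roles of the
smoothings are exchanged (`red_row_zero`, `red_row_infty`). The inequality between `det L_0` and
`det L_∞` fixes the sign inside the absolute value, so the determinants add up.

The bracket counts `circles - 1` loops and is therefore awkward to evaluate slice by slice. The
proof uses instead the unnormalised state sum `eval`, a recursion over the slices whose only memory
is a matching of the strand positions. Matchings live on all of `ℕ`, so that identities of `eval`
need no condition on strand numbers. At `ζ` itself this sum would vanish. Over the dual numbers `ζ`
is deformed so that a loop has value `ε`; the sum of a nonempty link diagram is then `ε` times its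
bracket at `ζ` (`eval_dualZeta`). Invariance of `det` under the local moves follows from the same
recursion. -/

namespace QALink

/-! ### Matchings -/

/-- A fixed-point free involution of `ℕ`: it records how the strands that leave a stack of slices
are joined below. -/
@[ext]
structure Matching where
  partner : ℕ → ℕ
  invol : ∀ j, partner (partner j) = j
  ne_self : ∀ j, partner j ≠ j

namespace Matching

/-- Opens a gap of two positions at `i`. -/
def gap (i j : ℕ) : ℕ := if j < i then j else j + 2

/-- Closes the gap of two positions at `i`. -/
def ungap (i j : ℕ) : ℕ := if j < i then j else j - 2

theorem gap_ne (i j : ℕ) : gap i j ≠ i := by unfold gap; grind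

theorem gap_ne_succ (i j : ℕ) : gap i j ≠ i + 1 := by unfold gap; grind

theorem gap_inj {i j k : ℕ} : gap i j = gap i k ↔ j = k := by unfold gap; grind

theorem ungap_gap (i j : ℕ) : ungap i (gap i j) = j := by unfold gap ungap; grind

theorem gap_ungap {i j : ℕ} (h : j ≠ i) (h' : j ≠ i + 1) : gap i (ungap i j) = j := by
  unfold gap ungap; grind

theorem gap_gap {i j : ℕ} (h : i ≤ j) (x : ℕ) : gap i (gap j x) = gap (j + 2) (gap i x) := by
  unfold gap; grind

/-- The partner of `z` after the positions `i` and `i + 1` are joined. -/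
def join (i : ℕ) (p : Matching) (z : ℕ) : ℕ :=
  if p.partner z = i then p.partner (i + 1)
  else if p.partner z = i + 1 then p.partner i else p.partner z

theorem join_ne (i : ℕ) (p : Matching) {z : ℕ} (h : z ≠ i) (h' : z ≠ i + 1) :
    join i p z ≠ i ∧ join i p z ≠ i + 1 := by
  have h1 := p.invol
  have h2 := p.ne_self
  unfold join
  grind

theorem join_join (i : ℕ) (p : Matching) {z : ℕ} (h : z ≠ i) (h' : z ≠ i + 1) :
    join i p (join i p z) = z := by
  have h1 := p.invol
  have h2 := p.ne_self
  unfold join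
  grind

theorem join_ne_self (i : ℕ) (p : Matching) (z : ℕ) : join i p z ≠ z := by
  have h1 := p.invol
  have h2 := p.ne_self
  unfold join
  grind

/-- The matching above a minimum at position `i`. -/
def addCup (i : ℕ) (p : Matching) : Matching where
  partner j := if j = i then i + 1 else if j = i + 1 then i else gap i (p.partner (ungap i j))
  invol j := by
    have h1 := p.invol
    have h2 := p.ne_self
    unfold gap ungap
    grind
  ne_self j := by
    have h1 := p.invol
    have h2 := p.ne_self
    unfold gap ungap
    grind

/-- The matching above a maximum at position `i`. -/
def addCap (i : ℕ) (p : Matching) : Matching where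
  partner j := ungap i (join i p (gap i j))
  invol j := by
    have h := join_ne i p (gap_ne i j) (gap_ne_succ i j)
    rw [gap_ungap h.1 h.2, join_join i p (gap_ne i j) (gap_ne_succ i j), ungap_gap]
  ne_self j e := by
    have h := join_ne i p (gap_ne i j) (gap_ne_succ i j)
    apply join_ne_self i p (gap i j)
    rw [← gap_ungap h.1 h.2, e]

theorem addCup_self (i : ℕ) (p : Matching) : (p.addCup i).partner i = i + 1 := by simp [addCup]

theorem addCup_succ (i : ℕ) (p : Matching) : (p.addCup i).partner (i + 1) = i := by simp [addCup]

theorem addCup_gap (i : ℕ) (p : Matching) (x : ℕ) :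
    (p.addCup i).partner (gap i x) = gap i (p.partner x) := by
  simp [addCup, gap_ne, gap_ne_succ, ungap_gap]

/-- Describes `addCap` before renumbering. As `gap i` is injective, identities between matchings can
be checked after applying it, which avoids the truncated subtraction in `ungap`. -/
theorem gap_addCap (i : ℕ) (p : Matching) (x : ℕ) :
    gap i ((p.addCap i).partner x) = join i p (gap i x) := by
  have h := join_ne i p (gap_ne i x) (gap_ne_succ i x)
  simp [addCap, gap_ungap h.1 h.2]

theorem eq_or_gap (i x : ℕ) : x = i ∨ x = i + 1 ∨ ∃ y, x = gap i y := by
  by_cases h : x = i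
  · exact .inl h
  by_cases h' : x = i + 1
  · exact .inr (.inl h')
  exact .inr (.inr ⟨_, (gap_ungap h h').symm⟩)

theorem addCap_addCup_self (i : ℕ) (p : Matching) : (p.addCup i).addCap i = p := by
  ext j
  rw [← gap_inj (i := i), gap_addCap, join, addCup_gap, if_neg (gap_ne _ _),
    if_neg (gap_ne_succ _ _)]

theorem addCap_addCup_left (i : ℕ) (p : Matching) : (p.addCup (i + 1)).addCap i = p := by
  have h1 := p.invol
  have h2 := p.ne_self
  ext j
  simp only [addCap, join, addCup, gap, ungap]
  grind

theorem addCap_addCup_right (i : ℕ) (p : Matching) : (p.addCup i).addCap (i + 1) = p := by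
  have h1 := p.invol
  have h2 := p.ne_self
  ext j
  simp only [addCap, join, addCup, gap, ungap]
  grind

theorem addCup_addCup (i j : ℕ) (h : i ≤ j) (p : Matching) :
    (p.addCup i).addCup (j + 2) = (p.addCup j).addCup i := by
  have e1 : i = gap (j + 2) i := by unfold gap; grind
  have e2 : i + 1 = gap (j + 2) (i + 1) := by unfold gap; grind
  have e3 : j + 2 = gap i j := by unfold gap; grind
  have e4 : j + 3 = gap i (j + 1) := by unfold gap; grind
  ext x
  obtain rfl | rfl | ⟨y, rfl⟩ := eq_or_gap (j + 2) x
  · rw [addCup_self]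
    rw (occs := [2]) [e3]
    rw [addCup_gap, addCup_self, ← e4]
  · rw [addCup_succ, show j + 2 + 1 = j + 3 from rfl, e4, addCup_gap, addCup_succ, e3]
  · rw [addCup_gap]
    obtain rfl | rfl | ⟨z, rfl⟩ := eq_or_gap i y
    · rw [← e1, addCup_self, addCup_self, ← e2]
    · rw [← e2, addCup_succ, addCup_succ, ← e1]
    · rw [addCup_gap, ← gap_gap h, ← gap_gap h, addCup_gap, addCup_gap]

theorem join_addCup (i j : ℕ) (h : i ≤ j) (p : Matching) (x : ℕ) :
    join (j + 2) (p.addCup i) (gap i x) = gap i (join j p x) := by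
  have e3 : j + 2 = gap i j := by unfold gap; grind
  have e4 : j + 2 + 1 = gap i (j + 1) := by unfold gap; grind
  simp only [join, addCup_gap, e4]
  simp only [e3, addCup_gap, gap_inj]
  split_ifs <;> rfl

theorem addCap_addCup_of_le (i j : ℕ) (h : i ≤ j) (p : Matching) :
    (p.addCup i).addCap (j + 2) = (p.addCap j).addCup i := by
  have e1 : i = gap (j + 2) i := by unfold gap; grind
  have e2 : i + 1 = gap (j + 2) (i + 1) := by unfold gap; grind
  ext x
  rw [← gap_inj (i := j + 2), gap_addCap]
  obtain rfl | rfl | ⟨y, rfl⟩ := eq_or_gap i x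
  · rw [← e1, addCup_self, ← e2, join, addCup_self]
    grind
  · rw [← e2, addCup_succ, ← e1, join, addCup_succ]
    grind
  · rw [addCup_gap, ← gap_gap h, ← gap_gap h, gap_addCap, join_addCup i j h]

theorem join_addCup_of_le (i j : ℕ) (h : i ≤ j) (p : Matching) (x : ℕ) :
    join i (p.addCup (j + 2)) (gap (j + 2) x) = gap (j + 2) (join i p x) := by
  have e1 : i = gap (j + 2) i := by unfold gap; grind
  have e2 : i + 1 = gap (j + 2) (i + 1) := by unfold gap; grind
  have a1 := addCup_gap (j + 2) p i
  have a2 := addCup_gap (j + 2) p (i + 1)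
  rw [← e1] at a1
  rw [← e2] at a2
  have b1 : ∀ y, gap (j + 2) y = i ↔ y = i := fun y => by
    rw (occs := [1]) [e1]
    exact gap_inj
  have b2 : ∀ y, gap (j + 2) y = i + 1 ↔ y = i + 1 := fun y => by
    rw (occs := [1]) [e2]
    exact gap_inj
  simp only [join, addCup_gap, b1, b2, a1, a2]
  split_ifs <;> rfl

theorem addCup_addCap_of_le (i j : ℕ) (h : i ≤ j) (p : Matching) :
    (p.addCap i).addCup j = (p.addCup (j + 2)).addCap i := by
  have e3 : j + 2 = gap i j := by unfold gap; grind
  have e4 : j + 2 + 1 = gap i (j + 1) := by unfold gap; grind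
  ext x
  rw [← gap_inj (i := i), gap_addCap]
  obtain rfl | rfl | ⟨y, rfl⟩ := eq_or_gap j x
  · rw [addCup_self, ← e4, ← e3, join, addCup_self]
    grind
  · rw [addCup_succ, ← e4, ← e3, join, addCup_succ]
    grind
  · rw [addCup_gap, gap_gap h, gap_gap h, gap_addCap, join_addCup_of_le i j h]

/-- Pushes a renumbering through `join`, so that two successive maxima can be compared in the
original numbering. -/
theorem gap_join (k i : ℕ) (p : Matching) (z : ℕ) : gap k (join i p z) =
    if gap k (p.partner z) = gap k i then gap k (p.partner (i + 1))
    else if gap k (p.partner z) = gap k (i + 1) then gap k (p.partner i)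
    else gap k (p.partner z) := by
  simp only [gap_inj, join]
  split_ifs <;> rfl

theorem addCap_addCap (i j : ℕ) (h : i ≤ j) (p : Matching) :
    (p.addCap i).addCap j = (p.addCap (j + 2)).addCap i := by
  have h1 := p.invol
  have h2 := p.ne_self
  have e1 : i = gap (j + 2) i := by unfold gap; grind
  have e2 : i + 1 = gap (j + 2) (i + 1) := by unfold gap; grind
  have e3 : j + 2 = gap i j := by unfold gap; grind
  have e4 : j + 2 + 1 = gap i (j + 1) := by unfold gap; grind
  -- In the original numbering: joining two disjoint pairs of positions gives the same matching in
  -- either order.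
  have key : ∀ z, z ≠ i → z ≠ i + 1 → z ≠ j + 2 → z ≠ j + 2 + 1 →
      (if join i p z = j + 2 then join i p (j + 2 + 1)
        else if join i p z = j + 2 + 1 then join i p (j + 2) else join i p z) =
      (if join (j + 2) p z = i then join (j + 2) p (i + 1)
        else if join (j + 2) p z = i + 1 then join (j + 2) p i else join (j + 2) p z) := by
    intro z
    unfold join
    grind
  ext x
  rw [← gap_inj (i := j), ← gap_inj (i := i), gap_addCap, gap_gap h, gap_addCap,
    gap_join i, gap_join (j + 2)]
  simp only [gap_addCap]
  rw [← e1, ← e2, ← e3, ← e4, gap_gap h]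
  apply key
  · rw [← gap_gap h]; exact gap_ne _ _
  · rw [← gap_gap h]; exact gap_ne_succ _ _
  · exact gap_ne _ _
  · exact gap_ne_succ _ _

end Matching

/-! ### The state sum with values in a commutative ring -/

section Eval

variable {R : Type*} [CommRing R]

/-- The weight of the vertical smoothing of a crossing. -/
def turn (a : Rˣ) (s : Bool) : Rˣ := if s then a else a⁻¹

theorem turn_not (a : Rˣ) (s : Bool) : turn a (!s) = (turn a s)⁻¹ := by
  cases s <;> simp [turn]

/-- The value of a closed curve. -/
def loopValue (a : Rˣ) : R := -(a : R) ^ 2 - ((a⁻¹ : Rˣ) : R) ^ 2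

theorem loopValue_turn (a : Rˣ) (s : Bool) :
    loopValue a = -(turn a s : R) ^ 2 - (((turn a s)⁻¹ : Rˣ) : R) ^ 2 := by
  cases s
  · simp [turn, loopValue]
    ring
  · simp [turn, loopValue]

/-- The factor that a maximum contributes: a closed curve may be completed. -/
def capWeight (a : Rˣ) (i : ℕ) (p : Matching) : R :=
  if p.partner i = i + 1 then loopValue a else 1

/-- The state sum of a stack of slices whose lower ends are joined according to a matching. -/
def eval (a : Rˣ) : Word → Matching → R
  | [], _ => 1
  | ⟨.cup, i⟩ :: w, p => eval a w (p.addCup i)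
  | ⟨.cap, i⟩ :: w, p => capWeight a i p * eval a w (p.addCap i)
  | ⟨.cross s, i⟩ :: w, p =>
      turn a s * eval a w p +
        ((turn a s)⁻¹ : Rˣ) * (capWeight a i p * eval a w ((p.addCap i).addCup i))

open Matching

theorem capWeight_addCup_self (a : Rˣ) (i : ℕ) (p : Matching) :
    capWeight a i (p.addCup i) = loopValue a := by simp [capWeight, addCup_self]

theorem capWeight_succ_addCup (a : Rˣ) (i : ℕ) (p : Matching) :
    capWeight a (i + 1) (p.addCup i) = 1 := by
  rw [capWeight, addCup_succ, if_neg (by omega)]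

theorem capWeight_addCup_succ (a : Rˣ) (i : ℕ) (p : Matching) :
    capWeight a i (p.addCup (i + 1)) = 1 := by
  have h1 := addCup_self (i + 1) p
  have h2 := (p.addCup (i + 1)).invol i
  rw [capWeight, if_neg]
  intro h
  rw [h] at h2
  omega

theorem capWeight_addCup_of_le (a : Rˣ) {i j : ℕ} (h : i ≤ j) (p : Matching) :
    capWeight a (j + 2) (p.addCup i) = capWeight a j p := by
  have e3 : j + 2 = gap i j := by unfold gap; grind
  have e4 : j + 2 + 1 = gap i (j + 1) := by unfold gap; grind
  rw [capWeight, capWeight, e4, e3, addCup_gap]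
  simp only [gap_inj]

theorem capWeight_addCup_of_ge (a : Rˣ) {i j : ℕ} (h : i ≤ j) (p : Matching) :
    capWeight a i (p.addCup (j + 2)) = capWeight a i p := by
  have e1 : i = gap (j + 2) i := by unfold gap; grind
  have e2 : i + 1 = gap (j + 2) (i + 1) := by unfold gap; grind
  have := addCup_gap (j + 2) p i
  rw [← e1] at this
  have c : gap (j + 2) (p.partner i) = i + 1 ↔ p.partner i = i + 1 := by
    rw (occs := [1]) [e2]
    exact gap_inj
  simp only [capWeight, this, c]

/-- Two maxima close the same total number of curves in either order, although which of them closes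
a given curve may depend on the order. -/
theorem capWeight_mul_capWeight (a : Rˣ) {i j : ℕ} (h : i ≤ j) (p : Matching) :
    capWeight a i p * capWeight a j (p.addCap i) =
      capWeight a (j + 2) p * capWeight a i (p.addCap (j + 2)) := by
  have h1 := p.invol
  have h2 := p.ne_self
  have e1 : i = gap (j + 2) i := by unfold gap; grind
  have e2 : i + 1 = gap (j + 2) (i + 1) := by unfold gap; grind
  have e3 : j + 2 = gap i j := by unfold gap; grind
  have e4 : j + 2 + 1 = gap i (j + 1) := by unfold gap; grind
  have c1 : (p.addCap i).partner j = j + 1 ↔ join i p (j + 2) = j + 2 + 1 := by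
    rw [← gap_inj (i := i), gap_addCap, ← e3, ← e4]
  have c2 : (p.addCap (j + 2)).partner i = i + 1 ↔ join (j + 2) p i = i + 1 := by
    rw [← gap_inj (i := j + 2), gap_addCap, ← e1, ← e2]
  simp only [capWeight, c1, c2]
  unfold join
  grind

/-- The state sum does not change under the exchange of distant slices. -/
theorem eval_exchange (a : Rˣ) (k l : Kind) {i j : ℕ} (h : i ≤ j) (v : Word) (p : Matching) :
    eval a (⟨k, i⟩ :: ⟨l, j + k.outputs⟩ :: v) p = eval a (⟨l, j + k.inputs⟩ :: ⟨k, i⟩ :: v) p := by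
  have w : ∀ q : Matching, capWeight a i q * capWeight a (j + 2) ((q.addCap i).addCup i) =
      capWeight a (j + 2) q * capWeight a i (q.addCap (j + 2)) := fun q => by
    rw [capWeight_addCup_of_le a h, capWeight_mul_capWeight a h]
  have w' : ∀ q : Matching, capWeight a i ((q.addCap (j + 2)).addCup (j + 2)) =
      capWeight a i (q.addCap (j + 2)) := fun q => capWeight_addCup_of_ge a h _
  have m := addCap_addCap i j h
  rcases k with _ | _ | s <;> rcases l with _ | _ | r <;>
    simp only [eval, Kind.inputs, Kind.outputs, Nat.add_zero]
  · rw [addCup_addCup i j h]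
  · rw [capWeight_addCup_of_le a h, addCap_addCup_of_le i j h]
  · rw [capWeight_addCup_of_le a h, addCap_addCup_of_le i j h, addCup_addCup i j h]
  · rw [capWeight_addCup_of_ge a h, addCup_addCap_of_le i j h]
  · rw [← mul_assoc, ← mul_assoc, capWeight_mul_capWeight a h, m]
  · rw [w', ← addCup_addCap_of_le i j h, ← m]
    linear_combination (((turn a r)⁻¹ : Rˣ) : R) *
      eval a v (((p.addCap i).addCap j).addCup j) * capWeight_mul_capWeight a h p
  · rw [capWeight_addCup_of_ge a h, addCup_addCup i j h, addCup_addCap_of_le i j h]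
  · rw [addCap_addCup_of_le i j h, ← m]
    linear_combination (((turn a s)⁻¹ : Rˣ) : R) *
      eval a v (((p.addCap i).addCap j).addCup i) * w p
  · rw [w', addCap_addCup_of_le i j h, addCup_addCup i j h, ← addCup_addCap_of_le i j h, ← m]
    linear_combination (((turn a s)⁻¹ : Rˣ) : R) * (((turn a r)⁻¹ : Rˣ) : R) *
      eval a v ((((p.addCap i).addCap j).addCup j).addCup i) * w p

/-- The recursion is linear in the values of the upper part, so a relation that holds for every
incoming matching survives any slices put below. -/
theorem eval_append (a : Rˣ) {x y : Word} {c : R} (h : ∀ p, eval a x p = c * eval a y p) (u : Word)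
    (p : Matching) : eval a (u ++ x) p = c * eval a (u ++ y) p := by
  induction u generalizing p with
  | nil => exact h p
  | cons e u ih =>
    rcases e with ⟨_ | _ | s, i⟩ <;> simp only [eval, List.cons_append, ih] <;> ring

/-- A local move multiplies the state sum by a power of the weight of a crossing. -/
theorem eval_localMove (a : Rˣ) {x y : Word} (h : LocalMove x y) :
    ∃ c : Rˣ, (c = 1 ∨ ∃ s, c = -(turn a s) ^ 3) ∧
      ∀ v p, eval a (x ++ v) p = c * eval a (y ++ v) p := by
  have inv : ∀ s, (turn a s : R) * ((turn a s)⁻¹ : Rˣ) = 1 := fun s => Units.mul_inv _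
  rcases h with ⟨k, l, i, j, h⟩ | i | i | ⟨s, i⟩ | ⟨s, i⟩ | ⟨s, i⟩ | ⟨s, i⟩ | ⟨s, i⟩ | ⟨s, i⟩
  · exact ⟨1, .inl rfl, fun v p => by simpa using eval_exchange a k l h v p⟩
  · refine ⟨1, .inl rfl, fun v p => ?_⟩
    simp [eval, capWeight_addCup_succ, addCap_addCup_left]
  · refine ⟨1, .inl rfl, fun v p => ?_⟩
    simp [eval, capWeight_succ_addCup, addCap_addCup_right]
  -- Next to a maximum or a minimum the slide interchanges the two smoothings, and the change of
  -- sign interchanges their weights.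
  · refine ⟨1, .inl rfl, fun v p => ?_⟩
    simp only [List.cons_append, List.nil_append, eval, capWeight_succ_addCup, addCap_addCup_right,
      capWeight_addCup_succ, addCap_addCup_left, turn_not, inv_inv, Units.val_one]
    ring
  · refine ⟨1, .inl rfl, fun v p => ?_⟩
    simp only [List.cons_append, List.nil_append, eval, capWeight_succ_addCup, addCap_addCup_right,
      capWeight_addCup_succ, addCap_addCup_left, turn_not, inv_inv, Units.val_one]
    ring
  -- With `t = turn a s` and loop value `δ = -t² - t⁻²`, a kink contributes `t + t⁻¹δ = -t⁻³`.
  · refine ⟨-(turn a (!s)) ^ 3, .inr ⟨!s, rfl⟩, fun v p => ?_⟩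
    simp only [List.cons_append, List.nil_append, eval, capWeight_addCup_self, addCap_addCup_self,
      turn_not, Units.val_neg, Units.val_pow_eq_pow_val]
    rw [loopValue_turn a s]
    linear_combination -(turn a s : R) * capWeight a i p * eval a v (p.addCap i) * inv s
  · refine ⟨-(turn a (!s)) ^ 3, .inr ⟨!s, rfl⟩, fun v p => ?_⟩
    simp only [List.cons_append, List.nil_append, eval, capWeight_addCup_self, addCap_addCup_self,
      turn_not, Units.val_neg, Units.val_pow_eq_pow_val]
    rw [loopValue_turn a s]
    linear_combination -(turn a s : R) * eval a v (p.addCup i) * inv s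
  · refine ⟨1, .inl rfl, fun v p => ?_⟩
    simp only [List.cons_append, List.nil_append, eval, capWeight_addCup_self, addCap_addCup_self,
      turn_not, inv_inv, Units.val_one]
    rw [loopValue_turn a s]
    linear_combination (eval a v p - ((turn a s : R) ^ 2 + (((turn a s)⁻¹ : Rˣ) : R) ^ 2) *
      capWeight a i p * eval a v ((p.addCap i).addCup i)) * inv s
  · refine ⟨1, .inl rfl, fun v p => ?_⟩
    simp only [List.cons_append, List.nil_append, eval, capWeight_addCup_self, addCap_addCup_self,
      capWeight_succ_addCup, addCap_addCup_right, capWeight_addCup_succ, addCap_addCup_left,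
      Units.val_one]
    rw [loopValue_turn a s]
    set x : R := (turn a s : R)
    set y : R := (((turn a s)⁻¹ : Rˣ) : R)
    have hxy : x * y = 1 := inv s
    -- The horizontal smoothing at `i` has coefficient `2x²y + xy²δ + y³` on the left and `x²y` on
    -- the right. These agree for `δ = -x² - y²` and `xy = 1`; at `i + 1` the sides are exchanged.
    linear_combination (-(x ^ 2 * y + y ^ 3)) * (capWeight a i p * eval a v ((p.addCap i).addCup i) -
      capWeight a (i + 1) p * eval a v ((p.addCap (i + 1)).addCup (i + 1))) * hxy

end Eval

/-! ### Counting closed curves -/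

theorem strandsAbove_append (m : ℕ) (u v : Word) :
    strandsAbove m (u ++ v) = (strandsAbove m u).bind fun m' => strandsAbove m' v := by
  induction u generalizing m with
  | nil => rfl
  | cons e u ih =>
    simp only [List.cons_append, strandsAbove, Option.bind_assoc, ih]

theorem Slice.apply_eq_some {e : Slice} {m n : ℕ} :
    e.apply m = some n ↔ e.pos + e.kind.inputs ≤ m ∧ m - e.kind.inputs + e.kind.outputs = n := by
  unfold Slice.apply
  split_ifs with h <;> simp [h]

theorem strandsAbove_concat {m n : ℕ} {w : Word} {e : Slice}
    (h : strandsAbove m (w ++ [e]) = some n) :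
    ∃ k, strandsAbove m w = some k ∧ e.pos + e.kind.inputs ≤ k ∧
      n = k - e.kind.inputs + e.kind.outputs := by
  rw [strandsAbove_append] at h
  obtain ⟨k, hk, h⟩ := Option.bind_eq_some_iff.1 h
  simp only [strandsAbove, Slice.apply, Option.bind_fun_some] at h
  split_ifs at h with h'
  exact ⟨k, hk, h', (Option.some.inj h).symm⟩

/-- The points of a diagram as a predicate. -/
def IsPoint (w : Word) (x : ℕ × ℕ) : Prop :=
  x.1 ≤ w.length ∧ ∃ m, strandsAbove 0 (w.take x.1) = some m ∧ x.2 < m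

theorem isPoint_append {w v : Word} {x : ℕ × ℕ} (h : x.1 ≤ w.length) :
    IsPoint (w ++ v) x ↔ IsPoint w x := by
  simp only [IsPoint, List.length_append, List.take_append_of_le_length h]
  exact and_congr_left fun _ => ⟨fun _ => h, fun _ => by omega⟩

theorem isPoint_length {w : Word} {m : ℕ} (h : strandsAbove 0 w = some m) (j : ℕ) :
    IsPoint w (w.length, j) ↔ j < m := by
  simp [IsPoint, h]

/-- Two points that lie on the same closed curve or arc. -/
def Conn (w : Word) (x y : ℕ × ℕ) : Prop :=
  ∃ (hx : IsPoint w x) (hy : IsPoint w y),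
    (Quot.mk (Joined w) ⟨x, hx⟩ : Quot (Joined w)) = Quot.mk (Joined w) ⟨y, hy⟩

theorem Conn.refl {w : Word} {x : ℕ × ℕ} (h : IsPoint w x) : Conn w x x := ⟨h, h, rfl⟩

theorem Conn.symm {w : Word} {x y : ℕ × ℕ} : Conn w x y → Conn w y x
  | ⟨hx, hy, h⟩ => ⟨hy, hx, h.symm⟩

theorem Conn.trans {w : Word} {x y z : ℕ × ℕ} : Conn w x y → Conn w y z → Conn w x z
  | ⟨hx, _, h⟩, ⟨_, hz, h'⟩ => ⟨hx, hz, h.trans h'⟩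

theorem Conn.append {w : Word} {x y : ℕ × ℕ} (v : Word) : Conn w x y → Conn (w ++ v) x y := by
  rintro ⟨hx, hy, h⟩
  let f : Point w → Point (w ++ v) := fun z => ⟨z.1, (isPoint_append z.2.1).2 z.2⟩
  have hf : ∀ a b, Joined w a b → Joined (w ++ v) (f a) (f b) := by
    rintro a b ⟨k, e, s, t, h1, h2, h3, h4⟩
    exact ⟨k, e, s, t, by rw [List.getElem?_append_left (List.getElem?_eq_some_iff.1 h1).1, h1],
      h2, h3, h4⟩
  exact ⟨(f ⟨x, hx⟩).2, (f ⟨y, hy⟩).2, congrArg (Quot.map f hf) h⟩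

theorem Conn.of_strand {w : Word} {e : Slice} {a b : End} (h : e.Strand a b)
    (ha : IsPoint (w ++ [e]) (a.place w.length)) (hb : IsPoint (w ++ [e]) (b.place w.length)) :
    Conn (w ++ [e]) (a.place w.length) (b.place w.length) :=
  ⟨ha, hb, Quot.sound ⟨w.length, e, a, b, by simp, h, rfl, rfl⟩⟩

/-- A function that is constant along strands is constant on connected points. -/
theorem Conn.apply_eq {w : Word} {e : Slice} {x y : ℕ × ℕ} (h : Conn (w ++ [e]) x y)
    (f : ℕ × ℕ → ℕ) (hf : ∀ x y, Conn w x y → f x = f y)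
    (hf' : ∀ a b, e.Strand a b → f (a.place w.length) = f (b.place w.length)) : f x = f y := by
  obtain ⟨hx, hy, h⟩ := h
  refine congrArg (Quot.lift (fun z : Point (w ++ [e]) => f z.1) ?_) h
  rintro ⟨a, ha⟩ ⟨b, hb⟩ ⟨k, e', s, t, h1, h2, h3, h4⟩
  change a = s.place k at h3
  change b = t.place k at h4
  change f a = f b
  have hk : k < w.length + 1 := by simpa using (List.getElem?_eq_some_iff.1 h1).1
  rcases Nat.lt_succ_iff_lt_or_eq.1 hk with hk | rfl
  · have place_le : ∀ s : End, (s.place k).1 ≤ w.length := by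
      rintro (j | j) <;> simp only [End.place] <;> omega
    have ha' := (isPoint_append (h3 ▸ place_le s)).1 ha
    have hb' := (isPoint_append (h4 ▸ place_le t)).1 hb
    rw [List.getElem?_append_left hk] at h1
    exact hf a b ⟨ha', hb', Quot.sound ⟨k, e', s, t, h1, h2, h3, h4⟩⟩
  · simp only [List.getElem?_concat_length, Option.some.injEq] at h1
    subst h1
    rw [h3, h4]
    exact hf' s t h2

/-- A labelling of the connected components of a stack of slices that starts with no strands and
ends with `m` strands, which are joined according to `p`. -/
structure Labelling (w : Word) (m : ℕ) (p : Matching) (l : ℕ × ℕ → ℕ) (S : Finset ℕ) : Prop where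
  mem : ∀ x, IsPoint w x → l x ∈ S
  surj : ∀ s ∈ S, ∃ x, IsPoint w x ∧ l x = s
  conn : ∀ x y, IsPoint w x → IsPoint w y → (l x = l y ↔ Conn w x y)
  lt : ∀ j < m, p.partner j < m
  top : ∀ j < m, ∀ j' < m, l (w.length, j) = l (w.length, j') ↔ j' = j ∨ j' = p.partner j

open Matching

theorem isPoint_concat {w : Word} {e : Slice} {n : ℕ}
    (h' : strandsAbove 0 (w ++ [e]) = some n) (x : ℕ × ℕ) :
    IsPoint (w ++ [e]) x ↔ IsPoint w x ∨ x.1 = w.length + 1 ∧ x.2 < n := by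
  rcases le_or_gt x.1 w.length with hx | hx
  · rw [isPoint_append hx]
    exact ⟨.inl, fun h => h.resolve_right (by omega)⟩
  · constructor
    · intro hp
      have h1 : x.1 = w.length + 1 := by
        have := hp.1
        simp only [List.length_append, List.length_singleton] at this
        omega
      refine .inr ⟨h1, ?_⟩
      obtain ⟨k, hk, hk'⟩ := hp.2
      rw [h1, List.take_of_length_le (by simp), h'] at hk
      rwa [Option.some.inj hk]
    · rintro (h | ⟨h1, h2⟩)
      · exact absurd h.1 (by omega)
      · refine ⟨by simp [h1], n, ?_, h2⟩
        rw [h1, List.take_of_length_le (by simp), h']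

theorem lt_of_gap_lt {i j m : ℕ} (hi : i + 2 ≤ m) : gap i j < m ↔ j < m - 2 := by
  unfold gap; split_ifs <;> omega

/-- Identifying the label `b` of position `i + 1` with the label `a` of position `i` has the same
effect on the remaining positions as `join`. -/
theorem join_labels {i z z' A B a b : ℕ} (p : Matching) (n1 : z ≠ i) (n2 : z ≠ i + 1)
    (n3 : z' ≠ i) (n4 : z' ≠ i + 1) (t1 : A = B ↔ z' = z ∨ z' = p.partner z)
    (t2 : A = a ↔ i = z ∨ i = p.partner z) (t3 : A = b ↔ i + 1 = z ∨ i + 1 = p.partner z)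
    (t4 : B = a ↔ i = z' ∨ i = p.partner z') (t5 : B = b ↔ i + 1 = z' ∨ i + 1 = p.partner z') :
    ((if A = b then a else A) = if B = b then a else B) ↔ z' = z ∨ z' = join i p z := by
  have i1 := p.invol i
  have i2 := p.invol (i + 1)
  have i3 := p.invol z
  have i4 := p.invol z'
  unfold join
  grind

/-- A maximum either merges two components, which loses a label, or closes up an arc whose two ends
it meets, which loses none. -/
theorem Labelling.cap {w : Word} {m n i : ℕ} {p : Matching} {l : ℕ × ℕ → ℕ} {S : Finset ℕ}
    (L : Labelling w m p l S) (hw : strandsAbove 0 w = some m)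
    (hw' : strandsAbove 0 (w ++ [cap i]) = some n) (hi : i + 2 ≤ m) (hn : n = m - 2) :
    ∃ l' S', Labelling (w ++ [cap i]) n (p.addCap i) l' S' ∧
      S.card = S'.card + if p.partner i = i + 1 then 0 else 1 := by
  have pt := isPoint_concat hw'
  have pi : ∀ j, j < m → IsPoint w (w.length, j) := fun j h => (isPoint_length hw j).2 h
  set k := w.length with hk
  have le : ∀ {x}, IsPoint w x → x.1 ≤ k := fun h => h.1
  set a := l (k, i) with ha
  set b := l (k, i + 1) with hb
  have top := L.top
  have invol := p.invol
  have ne_self := p.ne_self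
  have hab : a = b ↔ p.partner i = i + 1 := by
    rw [ha, hb, top i (by omega) (i + 1) (by omega)]
    exact ⟨fun h => (h.resolve_left (by omega)).symm, fun h => .inr h.symm⟩
  -- The new labelling merges `b` into `a` and gives each point of the new top line the label of the
  -- point directly below it on the same strand, found by `pull`.
  let l0 : ℕ × ℕ → ℕ := fun x => if l x = b then a else l x
  let pull : ℕ × ℕ → ℕ × ℕ := fun x => if x.1 ≤ k then x else (k, gap i x.2)
  have pull_pt : ∀ x, IsPoint (w ++ [QALink.cap i]) x → IsPoint w (pull x) := by
    intro x hx
    rcases (pt x).1 hx with h | ⟨h1, h2⟩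
    · simpa only [pull, if_pos (le h)] using h
    · simp only [pull, h1, if_neg (show ¬ k + 1 ≤ k by omega)]
      exact pi _ ((lt_of_gap_lt hi).2 (hn ▸ h2))
  have old : ∀ {x}, IsPoint w x → IsPoint (w ++ [QALink.cap i]) x := fun h => (pt _).2 (.inl h)
  have pull_conn : ∀ x, IsPoint (w ++ [QALink.cap i]) x →
      Conn (w ++ [QALink.cap i]) (pull x) x := by
    intro x hx
    rcases (pt x).1 hx with h | ⟨h1, h2⟩
    · simpa only [pull, if_pos (le h)] using Conn.refl hx
    · have hp := old (pull_pt x hx)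
      obtain ⟨x1, j⟩ := x
      simp only at h1 h2
      subst h1
      simp only [pull, if_neg (show ¬ k + 1 ≤ k by omega)] at hp ⊢
      by_cases hj : j < i
      · have e : gap i j = j := by simp [gap, hj]
        rw [e] at hp ⊢
        exact Conn.of_strand (Slice.Strand.left .cap i j hj) hp hx
      · have e : gap i j = j + 2 := by simp [gap, hj]
        rw [e] at hp ⊢
        exact Conn.of_strand (Slice.Strand.right .cap i j (by omega)) hp hx
  have conn_ab : Conn (w ++ [QALink.cap i]) (k, i) (k, i + 1) :=
    Conn.of_strand (Slice.Strand.cap i) (old (pi _ (by omega))) (old (pi _ (by omega)))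
  have conn0 : ∀ x, IsPoint w x →
      ∃ y, IsPoint w y ∧ l y = l0 x ∧ Conn (w ++ [QALink.cap i]) y x := by
    intro x hx
    by_cases h : l x = b
    · refine ⟨(k, i), pi _ (by omega), by simp [l0, h, ha], ?_⟩
      exact conn_ab.trans (((L.conn _ _ (pi _ (by omega)) hx).1 h.symm).append _)
    · exact ⟨x, hx, by simp [l0, h], Conn.refl (old hx)⟩
  have l0b : a ≠ b → ∀ x, l0 x ≠ b := by
    intro h x
    simp only [l0]
    split_ifs with h'
    · exact h
    · exact h'
  refine ⟨fun x => l0 (pull x), if a = b then S else S.erase b, ⟨?_, ?_, ?_, ?_, ?_⟩, ?_⟩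
  · intro x hx
    obtain ⟨y, hy, e, -⟩ := conn0 _ (pull_pt x hx)
    have : l0 (pull x) ∈ S := e ▸ L.mem y hy
    by_cases h : a = b
    · simpa [h] using this
    · simpa [h] using ⟨l0b h _, this⟩
  · intro s hs
    have hs' : s ∈ S ∧ (s = b → a = b) := by
      by_cases h : a = b
      · simp_all
      · simp only [h, if_false, Finset.mem_erase] at hs
        exact ⟨hs.2, fun h' => absurd h' hs.1⟩
    obtain ⟨x, hx, rfl⟩ := L.surj s hs'.1
    refine ⟨x, old hx, ?_⟩
    simp only [pull, if_pos (le hx), l0]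
    split_ifs with h
    · exact (hs'.2 h).trans h.symm
    · rfl
  · intro x y hx hy
    constructor
    · intro h
      obtain ⟨x', hx', e, c⟩ := conn0 _ (pull_pt x hx)
      obtain ⟨y', hy', e', c'⟩ := conn0 _ (pull_pt y hy)
      have : Conn w x' y' := (L.conn _ _ hx' hy').1 (by rw [e, e']; exact h)
      exact ((pull_conn x hx).symm.trans c.symm).trans
        ((this.append _).trans (c'.trans (pull_conn y hy)))
    · intro h
      refine h.apply_eq (fun x => l0 (pull x)) ?_ ?_
      · rintro x y h
        have := (L.conn x y h.1 h.2.1).2 h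
        simp only [pull, if_pos (le h.1), if_pos (le h.2.1), l0, this]
      · intro s t h
        rcases h with ⟨_, _, j, h⟩ | ⟨_, _, j, h⟩ | _ | _ | _ | _
        · simp [End.place, pull, ← hk, gap, h]
        · simp [End.place, pull, ← hk, gap, Nat.not_lt.2 h, Kind.inputs, Kind.outputs]
        · simp only [End.place, pull, ← hk, le_refl, if_true, l0, ← ha, ← hb]
          split_ifs <;> rfl
  · intro j hj
    rw [hn] at hj ⊢
    rw [← lt_of_gap_lt hi] at hj ⊢
    rw [gap_addCap, join]
    have := L.lt
    split_ifs
    · exact this _ (by omega)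
    · exact this _ (by omega)
    · exact this _ hj
  · intro j hj j' hj'
    rw [hn, ← lt_of_gap_lt hi] at hj hj'
    have e : ∀ j, pull ((w ++ [QALink.cap i]).length, j) = (k, gap i j) := by
      intro j
      simp [pull, ← hk]
    simp only [e]
    rw [← gap_inj (i := i) (j := j') (k := j), ← gap_inj (i := i) (k := (p.addCap i).partner j),
      gap_addCap]
    have n1 := gap_ne i j
    have n2 := gap_ne_succ i j
    have n3 := gap_ne i j'
    have n4 := gap_ne_succ i j'
    generalize gap i j = z at *
    generalize gap i j' = z' at *
    have t1 := top z hj z' hj'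
    have t2 := top z hj i (by omega)
    have t3 := top z hj (i + 1) (by omega)
    have t4 := top z' hj' i (by omega)
    have t5 := top z' hj' (i + 1) (by omega)
    rw [← ha] at t2 t4
    rw [← hb] at t3 t5
    simp only [l0]
    exact join_labels p n1 n2 n3 n4 t1 t2 t3 t4 t5
  · by_cases h : a = b
    · simp [h, hab.1 h]
    · have : b ∈ S := L.mem _ (pi _ (by omega))
      rw [if_neg h, if_neg (fun h' => h (hab.2 h')), Finset.card_erase_add_one this]

theorem gap_lt_add_two {i j m : ℕ} (hi : i ≤ m) : gap i j < m + 2 ↔ j < m := by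
  unfold gap; split_ifs <;> omega

/-- A minimum starts a new component, which gets a label outside `S`; every other new top point
inherits the label below it. -/
theorem Labelling.cup {w : Word} {m n i : ℕ} {p : Matching} {l : ℕ × ℕ → ℕ} {S : Finset ℕ}
    (L : Labelling w m p l S) (hw : strandsAbove 0 w = some m)
    (hw' : strandsAbove 0 (w ++ [cup i]) = some n) (hi : i ≤ m) (hn : n = m + 2) :
    ∃ l' S', Labelling (w ++ [cup i]) n (p.addCup i) l' S' ∧ S'.card = S.card + 1 := by
  have pt := isPoint_concat hw'
  have pi : ∀ j, j < m → IsPoint w (w.length, j) := fun j h => (isPoint_length hw j).2 h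
  set k := w.length with hk
  have le : ∀ {x}, IsPoint w x → x.1 ≤ k := fun h => h.1
  obtain ⟨f, hf⟩ := Infinite.exists_notMem_finset S
  let l' : ℕ × ℕ → ℕ := fun x =>
    if x.1 ≤ k then l x else if x.2 = i ∨ x.2 = i + 1 then f else l (k, ungap i x.2)
  have l_old : ∀ {x}, IsPoint w x → l' x = l x := fun h => by simp only [l', if_pos (le h)]
  have l_i : l' (k + 1, i) = f := by simp [l']
  have l_i' : l' (k + 1, i + 1) = f := by simp [l']
  have l_gap : ∀ j, l' (k + 1, gap i j) = l (k, j) := by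
    intro j
    simp [l', gap_ne, gap_ne_succ, ungap_gap]
  have old : ∀ {x}, IsPoint w x → IsPoint (w ++ [QALink.cup i]) x := fun h => (pt _).2 (.inl h)
  have new : ∀ {j}, j < m + 2 → IsPoint (w ++ [QALink.cup i]) (k + 1, j) :=
    fun h => (pt _).2 (.inr ⟨rfl, hn ▸ h⟩)
  have conn_i : Conn (w ++ [QALink.cup i]) (k + 1, i) (k + 1, i + 1) :=
    Conn.of_strand (Slice.Strand.cup i) (new (by omega)) (new (by omega))
  have conn_gap : ∀ j < m, Conn (w ++ [QALink.cup i]) (k, j) (k + 1, gap i j) := by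
    intro j hj
    have hp := new ((gap_lt_add_two hi).2 hj)
    by_cases h : j < i
    · have e : gap i j = j := by simp [gap, h]
      rw [e] at hp ⊢
      exact Conn.of_strand (Slice.Strand.left .cup i j h) (old (pi _ hj)) hp
    · have e : gap i j = j + 2 := by simp [gap, h]
      rw [e] at hp ⊢
      exact Conn.of_strand (Slice.Strand.right .cup i j (by omega)) (old (pi _ hj)) hp
  have cases : ∀ x, IsPoint (w ++ [QALink.cup i]) x →
      (l' x = f ∧ Conn (w ++ [QALink.cup i]) (k + 1, i) x) ∨
      ∃ y, IsPoint w y ∧ l' x = l y ∧ Conn (w ++ [QALink.cup i]) y x := by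
    intro x hx
    rcases (pt x).1 hx with h | ⟨h1, h2⟩
    · exact .inr ⟨x, h, l_old h, Conn.refl hx⟩
    · obtain ⟨x1, j⟩ := x
      simp only at h1 h2
      subst h1
      obtain rfl | rfl | ⟨j, rfl⟩ := eq_or_gap i j
      · exact .inl ⟨l_i, Conn.refl hx⟩
      · exact .inl ⟨l_i', conn_i⟩
      · rw [hn, gap_lt_add_two hi] at h2
        exact .inr ⟨(k, j), pi _ h2, l_gap j, conn_gap j h2⟩
  refine ⟨l', insert f S, ⟨?_, ?_, ?_, ?_, ?_⟩, Finset.card_insert_of_notMem hf⟩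
  · intro x hx
    rcases cases x hx with ⟨h, -⟩ | ⟨y, hy, h, -⟩
    · simp [h]
    · rw [h]
      exact Finset.mem_insert_of_mem (L.mem y hy)
  · intro s hs
    rcases Finset.mem_insert.1 hs with rfl | hs
    · exact ⟨(k + 1, i), new (by omega), l_i⟩
    · obtain ⟨x, hx, rfl⟩ := L.surj s hs
      exact ⟨x, old hx, l_old hx⟩
  · intro x y hx hy
    constructor
    · intro h
      rcases cases x hx with ⟨e, c⟩ | ⟨x', hx', e, c⟩ <;>
        rcases cases y hy with ⟨e', c'⟩ | ⟨y', hy', e', c'⟩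
      · exact c.symm.trans c'
      · exact absurd (L.mem y' hy') (by rwa [← e', ← h, e])
      · exact absurd (L.mem x' hx') (by rwa [← e, h, e'])
      · exact c.symm.trans (((((L.conn _ _ hx' hy').1 (by rw [← e, ← e', h])).append _)).trans c')
    · intro h
      refine h.apply_eq l' ?_ ?_
      · rintro x y h
        rw [l_old h.1, l_old h.2.1]
        exact (L.conn x y h.1 h.2.1).2 h
      · intro s t h
        rcases h with ⟨_, _, j, h⟩ | ⟨_, _, j, h⟩ | _ | _ | _ | _
        · have e : gap i j = j := by simp [gap, h]
          have := l_gap j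
          rw [e] at this
          simpa [End.place, ← hk, l'] using this.symm
        · have e : gap i j = j + 2 := by simp [gap, Nat.not_lt.2 h]
          have := l_gap j
          rw [e] at this
          simpa [End.place, ← hk, l', Kind.inputs, Kind.outputs] using this.symm
        · simp only [End.place, ← hk, l_i, l_i']
  · intro j hj
    rw [hn] at hj ⊢
    obtain rfl | rfl | ⟨j, rfl⟩ := eq_or_gap i j
    · rw [addCup_self]; omega
    · rw [addCup_succ]; omega
    · rw [gap_lt_add_two hi] at hj
      rw [addCup_gap, gap_lt_add_two hi]
      exact L.lt j hj
  · intro j hj j' hj'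
    have len : (w ++ [QALink.cup i]).length = k + 1 := by simp [hk]
    have nf : ∀ j < m, l (k, j) ≠ f := fun j hj h => hf (h ▸ L.mem _ (pi j hj))
    rw [hn] at hj hj'
    rw [len]
    have g1 := gap_ne i
    have g2 := gap_ne_succ i
    obtain rfl | rfl | ⟨j, rfl⟩ := eq_or_gap i j
    · rw [addCup_self, l_i]
      obtain rfl | rfl | ⟨j', rfl⟩ := eq_or_gap j j'
      · simp [l_i]
      · simp [l_i']
      · rw [gap_lt_add_two hi] at hj'
        rw [l_gap]
        have := nf j' hj'
        simp [g1, g2, this.symm]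
    · rw [addCup_succ, l_i']
      obtain rfl | rfl | ⟨j', rfl⟩ := eq_or_gap i j'
      · simp [l_i]
      · simp [l_i']
      · rw [gap_lt_add_two hi] at hj'
        rw [l_gap]
        have := nf j' hj'
        simp [g1, g2, this.symm]
    · rw [gap_lt_add_two hi] at hj
      rw [addCup_gap, l_gap]
      have := nf j hj
      obtain rfl | rfl | ⟨j', rfl⟩ := eq_or_gap i j'
      · rw [l_i]
        simp [this, (g1 _).symm]
      · rw [l_i']
        simp [this, (g2 _).symm]
      · rw [gap_lt_add_two hi] at hj'
        rw [l_gap, gap_inj, gap_inj]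
        exact L.top j hj j' hj'

/-- The matching and the number of closed curves after one more slice. -/
def runStep (x : Matching × ℕ) (e : Slice) : Matching × ℕ :=
  match e.kind with
  | .cup => (x.1.addCup e.pos, x.2)
  | .cap => (x.1.addCap e.pos, if x.1.partner e.pos = e.pos + 1 then x.2 + 1 else x.2)
  | .cross _ => x

/-- A stack of slices without crossings. -/
def IsCrossingless (w : Word) : Prop := ∀ e ∈ w, e.kind = .cup ∨ e.kind = .cap

/-- A component is either a closed curve or an arc that uses two of the `m` top ends; this gives the
count. The initial matching does not matter, because positions below `m` are matched among
themselves. -/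
theorem exists_labelling (p : Matching) {w : Word} (hw : IsCrossingless w) {m : ℕ}
    (hm : strandsAbove 0 w = some m) :
    ∃ l S, Labelling w m (w.foldl runStep (p, 0)).1 l S ∧
      2 * S.card = 2 * (w.foldl runStep (p, 0)).2 + m := by
  induction w using List.reverseRecOn generalizing m with
  | nil =>
    simp only [strandsAbove, Option.some.injEq] at hm
    subst hm
    have no : ∀ x, ¬ IsPoint [] x := by
      rintro x ⟨-, m, h, h'⟩
      simp only [List.take_nil, strandsAbove, Option.some.injEq] at h
      omega
    exact ⟨fun _ => 0, ∅, ⟨fun x h => absurd h (no x), fun s h => absurd h (by simp),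
      fun x y h => absurd h (no x), fun j h => absurd h (by omega),
      fun j h => absurd h (by omega)⟩, by simp⟩
  | append_singleton w e ih =>
    obtain ⟨k, hk, h1, h2⟩ := strandsAbove_concat hm
    obtain ⟨l, S, L, hS⟩ := ih (fun e he => hw e (by simp [he])) hk
    rw [List.foldl_concat]
    have he := hw e (by simp)
    obtain ⟨κ, i⟩ := e
    rcases he with he | he
    · simp only at he
      subst he
      simp only [Kind.inputs, Kind.outputs, Nat.add_zero, Nat.sub_zero] at h1 h2
      obtain ⟨l', S', L', h⟩ := L.cup hk hm h1 h2
      exact ⟨l', S', L', by simp only [runStep]; omega⟩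
    · simp only at he
      subst he
      simp only [Kind.inputs, Kind.outputs, Nat.add_zero] at h1 h2
      obtain ⟨l', S', L', h⟩ := L.cap hk hm h1 h2
      refine ⟨l', S', L', ?_⟩
      simp only [runStep]
      split_ifs at h ⊢ <;> omega

theorem circles_eq (p : Matching) {w : Word} (hw : IsCrossingless w) (hd : IsLinkDiagram w) :
    circles w = (w.foldl runStep (p, 0)).2 := by
  obtain ⟨l, S, L, hS⟩ := exists_labelling p hw hd
  have hl : ∀ a b : Point w, Joined w a b → l a.1 = l b.1 := fun a b h =>
    (L.conn _ _ a.2 b.2).2 ⟨a.2, b.2, Quot.sound h⟩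
  let f : Quot (Joined w) → S := Quot.lift (fun x => ⟨l x.1, L.mem _ x.2⟩)
    fun a b h => Subtype.ext (hl a b h)
  have : Function.Bijective f := by
    constructor
    · rintro ⟨a⟩ ⟨b⟩ h
      exact ((L.conn _ _ a.2 b.2).1 (congrArg Subtype.val h)).2.2
    · rintro ⟨s, hs⟩
      obtain ⟨x, hx, rfl⟩ := L.surj s hs
      exact ⟨Quot.mk _ ⟨x, hx⟩, rfl⟩
  rw [circles, Nat.card_eq_of_bijective f this, Nat.card_eq_fintype_card, Fintype.card_coe]
  omega

/-- The exponent `c` holds the curves closed before the word starts, as the induction over slices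
requires. -/
theorem eval_of_isCrossingless {R : Type*} [CommRing R] (a : Rˣ) {w : Word}
    (hw : IsCrossingless w) (p : Matching) (c : ℕ) :
    eval a w p * loopValue a ^ c = loopValue a ^ (w.foldl runStep (p, c)).2 := by
  induction w generalizing p c with
  | nil => simp [eval]
  | cons e w ih =>
    have he := hw e (by simp)
    have hw' : IsCrossingless w := fun e he => hw e (by simp [he])
    obtain ⟨κ, i⟩ := e
    rcases he with he | he <;> simp only at he <;> subst he
    · exact ih hw' _ _
    · rw [List.foldl_cons, ← ih hw']
      simp only [eval, capWeight, runStep]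
      split_ifs <;> ring

/-- The state sum of a link diagram without crossings. -/
theorem eval_eq_pow_circles {R : Type*} [CommRing R] (a : Rˣ) {w : Word}
    (hw : IsCrossingless w) (hd : IsLinkDiagram w) (p : Matching) :
    eval a w p = loopValue a ^ circles w := by
  simpa [circles_eq p hw hd] using eval_of_isCrossingless a hw p 0

/-- A matching to start the evaluation with. -/
def Matching.standard : Matching where
  partner j := if j % 2 = 0 then j + 1 else j - 1
  invol j := by grind
  ne_self j := by grind

/-- Needed because the exponent `circles - 1` in the bracket is a truncated subtraction. The first
slice has to be a minimum, so the diagram has a point. -/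
theorem circles_pos {w : Word} (hd : IsLinkDiagram w) (hw : IsCrossingless w) (h : w ≠ []) :
    0 < circles w := by
  obtain ⟨l, S, L, hS⟩ := exists_labelling .standard hw hd
  rw [circles_eq .standard hw hd]
  obtain ⟨e, v, rfl⟩ := List.exists_cons_of_ne_nil h
  suffices IsPoint (e :: v) (1, 0) by
    have := Finset.card_pos.2 ⟨_, L.mem _ this⟩
    omega
  have hm := hd
  simp only [IsLinkDiagram, strandsAbove] at hm
  obtain ⟨m, hm, -⟩ := Option.bind_eq_some_iff.1 hm
  refine ⟨by simp, m, by simp [strandsAbove, hm], ?_⟩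
  simp only [Slice.apply] at hm
  rcases hw e (by simp) with he | he <;> simp [he, Kind.inputs, Kind.outputs] at hm
  omega

/-! ### The determinant as the linear part of a state sum over the dual numbers -/

theorem eval_append₂ {R : Type*} [CommRing R] (a : Rˣ) {x y z : Word} {c d : R}
    (h : ∀ p, eval a x p = c * eval a y p + d * eval a z p) (u : Word) (p : Matching) :
    eval a (u ++ x) p = c * eval a (u ++ y) p + d * eval a (u ++ z) p := by
  induction u generalizing p with
  | nil => exact h p
  | cons e u ih =>
    rcases e with ⟨_ | _ | s, i⟩ <;> simp only [eval, List.cons_append, ih] <;> ring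

theorem eval_eq_sum_states {R : Type*} [CommRing R] (a : Rˣ) (w : Word) (p : Matching) :
    eval a w p = ((states w).map fun x => ((a ^ x.1 : Rˣ) : R) * eval a x.2 p).sum := by
  induction w generalizing p with
  | nil => simp [states, eval]
  | cons e w ih =>
    rcases e with ⟨_ | _ | s, i⟩
    · simp [states, eval, ih, Function.comp_def]
    · simp only [states, eval, ih, List.map_map, ← List.sum_map_mul_left, Function.comp_def]
      congr 1
      refine List.map_congr_left fun x _ => ?_
      ring
    · have h1 : turn a s = a ^ (if s then 1 else -1 : ℤ) := by cases s <;> simp [turn]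
      simp only [states, eval, ih, List.map_map, List.map_append, List.sum_append,
        ← List.sum_map_mul_left, Function.comp_def, h1, ← zpow_neg]
      congr 2
      · refine List.map_congr_left fun x _ => ?_
        rw [add_comm, zpow_add, Units.val_mul, mul_assoc]
      · refine List.map_congr_left fun x _ => ?_
        rw [sub_eq_neg_add, zpow_add, Units.val_mul]
        ring

theorem isCrossingless_of_mem_states {w : Word} {x : ℤ × Word} (h : x ∈ states w) :
    IsCrossingless x.2 := by
  induction w generalizing x with
  | nil =>
    simp only [states, List.mem_singleton] at h
    subst h
    intro e he
    simp at he
  | cons e w ih =>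
    rcases e with ⟨_ | _ | s, i⟩ <;> simp only [states, List.mem_append, List.mem_map] at h
    · obtain ⟨y, hy, rfl⟩ := h
      exact List.forall_mem_cons.2 ⟨.inl rfl, ih hy⟩
    · obtain ⟨y, hy, rfl⟩ := h
      exact List.forall_mem_cons.2 ⟨.inr rfl, ih hy⟩
    · rcases h with ⟨y, hy, rfl⟩ | ⟨y, hy, rfl⟩
      · exact ih (x := y) hy
      · exact List.forall_mem_cons.2 ⟨.inr rfl, List.forall_mem_cons.2 ⟨.inl rfl, ih hy⟩⟩

theorem strandsAbove_of_mem_states {w : Word} {x : ℤ × Word} (h : x ∈ states w) {m n : ℕ}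
    (hw : strandsAbove m w = some n) : strandsAbove m x.2 = some n := by
  induction w generalizing x m with
  | nil =>
    simp only [states, List.mem_singleton] at h
    subst h
    exact hw
  | cons e w ih =>
    obtain ⟨k, hk, hv⟩ := Option.bind_eq_some_iff.1 hw
    rcases e with ⟨_ | _ | s, i⟩ <;> simp only [states, List.mem_append, List.mem_map] at h
    · obtain ⟨y, hy, rfl⟩ := h
      exact Option.bind_eq_some_iff.2 ⟨k, hk, ih hy hv⟩
    · obtain ⟨y, hy, rfl⟩ := h
      exact Option.bind_eq_some_iff.2 ⟨k, hk, ih hy hv⟩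
    · obtain ⟨hi, hk⟩ := Slice.apply_eq_some.1 hk
      simp only [Kind.inputs, Kind.outputs] at hi hk
      obtain rfl : k = m := by omega
      rcases h with ⟨y, hy, rfl⟩ | ⟨y, hy, rfl⟩
      · exact ih (x := y) hy hv
      · have h1 : (cap i).apply k = some (k - 2) := Slice.apply_eq_some.2 ⟨hi, rfl⟩
        have h2 : (cup i).apply (k - 2) = some k :=
          Slice.apply_eq_some.2 ⟨by simp only [Kind.inputs]; omega, hk⟩
        exact Option.bind_eq_some_iff.2 ⟨_, h1, Option.bind_eq_some_iff.2 ⟨_, h2, ih hy hv⟩⟩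

theorem exists_eq_cup_cons {w : Word} (hw : IsLinkDiagram w) (h : w ≠ []) :
    ∃ i v, w = cup i :: v := by
  obtain ⟨⟨k, i⟩, v, rfl⟩ := List.exists_cons_of_ne_nil h
  obtain ⟨m, hm, -⟩ := Option.bind_eq_some_iff.1 hw
  rcases k with _ | _ | s
  · exact ⟨i, v, rfl⟩
  all_goals simp [Slice.apply, Kind.inputs] at hm

theorem ne_nil_of_mem_states {w : Word} (hw : IsLinkDiagram w) (h : w ≠ []) {x : ℤ × Word}
    (hx : x ∈ states w) : x.2 ≠ [] := by
  obtain ⟨i, v, rfl⟩ := exists_eq_cup_cons hw h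
  simp only [states, List.mem_map] at hx
  obtain ⟨y, -, rfl⟩ := hx
  simp

/-- The eighth root of unity at which the bracket computes the determinant. -/
noncomputable def zeta : ℂ := Complex.exp (Real.pi * Complex.I / 4)

theorem zeta_pow_four : zeta ^ 4 = -1 := by
  rw [zeta, ← Complex.exp_nat_mul, ← Complex.exp_pi_mul_I]
  congr 1
  push_cast
  ring

theorem zeta_ne_zero : zeta ≠ 0 := Complex.exp_ne_zero _

theorem norm_zeta : ‖zeta‖ = 1 := by
  have : zeta = Complex.exp ((Real.pi / 4 : ℝ) * Complex.I) := by
    rw [zeta]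
    congr 1
    push_cast
    ring
  rw [this, Complex.norm_exp_ofReal_mul_I]

open TrivSqZeroExt DualNumber

/-- An infinitesimal deformation of `zeta` for which a closed curve has the value `ε`. -/
noncomputable def dualZeta : (DualNumber ℂ)ˣ where
  -- The derivative of `-A² - A⁻²` at `ζ` is `-2ζ + 2ζ⁻³ = -4ζ`, as `ζ⁴ = -1`. The increment
  -- `-ζ⁻¹/4` therefore moves the loop value from `0` to `ε`.
  val := inl zeta + inr (-(zeta⁻¹ / 4))
  inv := inl zeta⁻¹ + inr (zeta⁻¹ ^ 3 / 4)
  val_inv := by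
    have := zeta_ne_zero
    ext
    · simp [this]
    · simp
      field_simp
      ring
  inv_val := by
    have := zeta_ne_zero
    ext
    · simp [this]
    · simp
      field_simp
      ring

theorem zeta_sq_add : zeta ^ 2 + (zeta ^ 2)⁻¹ = 0 := by
  have := zeta_ne_zero
  field_simp
  linear_combination zeta_pow_four

theorem loopValue_dualZeta : loopValue dualZeta = (ε : DualNumber ℂ) := by
  have h := zeta_ne_zero
  have h4 := zeta_pow_four
  have h2 := zeta_sq_add
  ext
  · simp only [loopValue, dualZeta, Units.val_mk, Units.inv_mk, pow_two, fst_sub, fst_neg, fst_mul,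
      fst_add, fst_inl, fst_inr, fst_eps, add_zero]
    rw [pow_two, mul_inv] at h2
    linear_combination -h2
  · simp only [loopValue, dualZeta, Units.val_mk, Units.inv_mk, pow_two, snd_sub, snd_neg, DualNumber.snd_mul,
      fst_add, fst_inl, fst_inr, snd_add, snd_inl, snd_inr, snd_eps, add_zero, zero_add]
    field_simp
    linear_combination (-2 : ℂ) * h4

theorem fst_dualZeta_zpow (k : ℤ) : ((dualZeta ^ k : (DualNumber ℂ)ˣ) : DualNumber ℂ).fst =
    zeta ^ k := by
  have h : ∀ u : (DualNumber ℂ)ˣ, (u : DualNumber ℂ).fst =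
      (Units.map (TrivSqZeroExt.fstHom ℂ ℂ ℂ : DualNumber ℂ →* ℂ) u : ℂ) := fun u => rfl
  rw [h, map_zpow, Units.val_zpow_eq_zpow_val, ← h]
  simp [dualZeta]

/-- Only states with exactly one curve survive, just as in the bracket at loop value `0`, where the
convention `0 ^ 0 = 1` is used. The values are multiples of `ε`, so only the `fst` part of a
coefficient matters. -/
theorem eps_pow {c : ℕ} (h : 0 < c) : (ε : DualNumber ℂ) ^ c = inr (0 ^ (c - 1)) := by
  obtain _ | _ | c := c
  · omega
  · rw [zero_add, pow_one, Nat.sub_self, pow_zero]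
    rfl
  · rw [pow_succ, pow_succ, mul_assoc, DualNumber.eps_mul_eps, mul_zero, Nat.add_sub_cancel,
      pow_succ, mul_zero, inr_zero]

/-- The state sum over the dual numbers of a non-empty link diagram. -/
theorem eval_dualZeta {w : Word} (hw : IsLinkDiagram w) (h : w ≠ []) (p : Matching) :
    eval dualZeta w p = inr (bracket zeta w) := by
  have hz : -zeta ^ 2 - (zeta ^ 2)⁻¹ = 0 := by linear_combination -zeta_sq_add
  rw [eval_eq_sum_states, bracket, hz]
  change _ = inrHom ℂ ℂ _
  rw [map_list_sum, List.map_map]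
  congr 1
  refine List.map_congr_left fun x hx => ?_
  have c := isCrossingless_of_mem_states hx
  have d : IsLinkDiagram x.2 := strandsAbove_of_mem_states hx hw
  rw [eval_eq_pow_circles _ c d, loopValue_dualZeta,
    eps_pow (circles_pos d c (ne_nil_of_mem_states hw h hx))]
  ext <;> simp [fst_dualZeta_zpow, mul_comm]

theorem det_eq (w : Word) : det w = ‖bracket zeta w‖ := rfl

theorem bracket_zeta_eq {w : Word} (hw : IsLinkDiagram w) (h : w ≠ []) :
    bracket zeta w = (eval dualZeta w Matching.standard).snd := by
  rw [eval_dualZeta hw h, snd_inr]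

theorem bracket_zeta_of_eval {w v : Word} (hw : IsLinkDiagram w) (hw0 : w ≠ [])
    (hv : IsLinkDiagram v) (hv0 : v ≠ []) {c : DualNumber ℂ}
    (h : ∀ p, eval dualZeta w p = c * eval dualZeta v p) :
    bracket zeta w = c.fst * bracket zeta v := by
  rw [bracket_zeta_eq hw hw0, h, eval_dualZeta hv hv0]
  simp [mul_comm]

theorem norm_fst_turn (s : Bool) : ‖(turn dualZeta s : DualNumber ℂ).fst‖ = 1 := by
  cases s <;> simp [turn, dualZeta, norm_zeta]

/-- The empty diagram has state sum `1`, which is not a multiple of `ε`, and must be kept apart. No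
move reaches it: a zigzag needs a strand beside it, and a crossing cannot be the first slice. -/
theorem DiagramStep.ne_nil {w w' : Word} (h : DiagramStep w w') : w ≠ [] ∧ w' ≠ [] := by
  obtain ⟨h, h', u, v, a, b, m, rfl, rfl⟩ := h
  constructor
  · rintro e
    simp only [List.append_eq_nil_iff] at e
    obtain ⟨⟨-, rfl⟩, -⟩ := e
    cases m
  · rintro e
    simp only [List.append_eq_nil_iff] at e
    obtain ⟨⟨rfl, rfl⟩, rfl⟩ := e
    cases m <;>
      simp [IsLinkDiagram, strandsAbove, Slice.apply, Kind.inputs, Kind.outputs] at h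
    rename_i i
    by_cases hi : i = 0 <;> simp [hi] at h

/-- A move changes the bracket at `ζ` by a factor of modulus `1`: either `1` or minus the cube of an
eighth root of unity. -/
theorem DiagramStep.det_eq {w w' : Word} (h : DiagramStep w w') : det w = det w' := by
  obtain ⟨h0, h0'⟩ := h.ne_nil
  obtain ⟨h, h', u, v, a, b, m, rfl, rfl⟩ := h
  obtain ⟨c, hc, hm⟩ := eval_localMove dualZeta m
  have := bracket_zeta_of_eval h h0 h' h0' (c := c) fun p => by
    rw [List.append_assoc, List.append_assoc]
    exact eval_append dualZeta (fun p => hm v p) u p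
  have hn : ‖(c : DualNumber ℂ).fst‖ = 1 := by
    rcases hc with rfl | ⟨s, rfl⟩
    · simp
    · simp [norm_fst_turn]
  rw [QALink.det_eq, QALink.det_eq, this, norm_mul, hn, one_mul]

theorem DiagramEquiv.det_eq {w w' : Word} (h : DiagramEquiv w w') : det w = det w' := by
  induction h with
  | rel _ _ h => exact h.det_eq
  | refl => rfl
  | symm _ _ _ h => exact h.symm
  | trans _ _ _ _ _ h h' => exact h.trans h'

theorem DiagramEquiv.isLinkDiagram {w w' : Word} (h : DiagramEquiv w w') :
    (IsLinkDiagram w ↔ IsLinkDiagram w') ∧ (w = [] ↔ w' = []) := by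
  induction h with
  | rel _ _ h => exact ⟨iff_of_true h.1 h.2.1, iff_of_false h.ne_nil.1 h.ne_nil.2⟩
  | refl => exact ⟨Iff.rfl, Iff.rfl⟩
  | symm _ _ _ h => exact ⟨h.1.symm, h.2.symm⟩
  | trans _ _ _ _ _ h h' => exact ⟨h.1.trans h'.1, h.2.trans h'.2⟩

theorem QuasiAlternating.isLinkDiagram {w : Word} (h : QuasiAlternating w) :
    IsLinkDiagram w ∧ w ≠ [] := by
  induction h with
  | unknot => exact ⟨by simp [IsLinkDiagram, strandsAbove, Slice.apply, Kind.inputs, Kind.outputs],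
      by simp⟩
  | equiv w w' h _ ih => exact ⟨h.isLinkDiagram.1.1 ih.1, mt h.isLinkDiagram.2.2 ih.2⟩
  | crossing c hd => exact ⟨hd, by simp [MarkedCrossing.diagram, MarkedCrossing.replace]⟩

/-- The determinant of a quasi-alternating link is positive. -/
theorem QuasiAlternating.one_le_det {w : Word} (h : QuasiAlternating w) : 1 ≤ det w := by
  induction h with
  | unknot =>
    obtain ⟨h1, h2⟩ := QuasiAlternating.unknot.isLinkDiagram
    rw [QALink.det_eq, bracket_zeta_eq h1 h2]
    simp [eval, capWeight_addCup_self, loopValue_dualZeta]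
  | equiv w w' h _ ih => rwa [← h.det_eq]
  | crossing c _ _ _ h =>
    obtain ⟨h0, h1, h⟩ := h
    linarith

/-! ### Rewriting diagrams locally -/

/-- The word `a` may be replaced by `b` inside every link diagram, without changing the link. -/
def Red (a b : Word) : Prop :=
  ∀ u v : Word, IsLinkDiagram (u ++ a ++ v) → DiagramEquiv (u ++ a ++ v) (u ++ b ++ v)

theorem Red.refl (a : Word) : Red a a := fun _ _ _ => .refl _

theorem Red.trans {a b c : Word} (h : Red a b) (h' : Red b c) : Red a c := fun u v d =>
  .trans _ _ _ (h u v d) (h' u v ((h u v d).isLinkDiagram.1.1 d))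

/-- Rewriting a part of a word. -/
theorem Red.within {a b : Word} (h : Red a b) (x y : Word) {w w' : Word} (e : w = x ++ a ++ y)
    (e' : w' = x ++ b ++ y) : Red w w' := by
  subst e e'
  intro u v
  simpa only [List.append_assoc] using h (u ++ x) (y ++ v)

theorem isLinkDiagram_replace {u a v : Word} (h : IsLinkDiagram (u ++ a ++ v)) :
    ∃ m n, strandsAbove 0 u = some m ∧ strandsAbove m a = some n ∧ strandsAbove n v = some 0 := by
  rw [IsLinkDiagram, List.append_assoc, strandsAbove_append] at h
  obtain ⟨m, hm, h⟩ := Option.bind_eq_some_iff.1 h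
  rw [strandsAbove_append] at h
  obtain ⟨n, hn, h⟩ := Option.bind_eq_some_iff.1 h
  exact ⟨m, n, hm, hn, h⟩

theorem isLinkDiagram_of_strandsAbove {u a v : Word} {m n : ℕ} (hu : strandsAbove 0 u = some m)
    (ha : strandsAbove m a = some n) (hv : strandsAbove n v = some 0) :
    IsLinkDiagram (u ++ a ++ v) := by
  simp [IsLinkDiagram, strandsAbove_append, hu, ha, hv]

theorem isLinkDiagram_congr {u a b v : Word} (h : IsLinkDiagram (u ++ a ++ v))
    (hab : ∀ m n, strandsAbove m a = some n → strandsAbove m b = some n) :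
    IsLinkDiagram (u ++ b ++ v) := by
  obtain ⟨m, n, hm, hn, h⟩ := isLinkDiagram_replace h
  exact isLinkDiagram_of_strandsAbove hm (hab _ _ hn) h

/-- The condition `hab` makes the new word fit wherever the old one did. It can fail in one
direction: a zigzag cannot be inserted where there are too few strands. For this reason `Red` is
directed. -/
theorem Red.of_localMove {a b : Word} (h : LocalMove a b)
    (hab : ∀ m n, strandsAbove m a = some n → strandsAbove m b = some n) : Red a b :=
  fun u v d => .rel _ _ ⟨d, isLinkDiagram_congr d hab, u, v, a, b, h, rfl, rfl⟩

theorem Red.of_localMove_symm {a b : Word} (h : LocalMove b a)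
    (hab : ∀ m n, strandsAbove m a = some n → strandsAbove m b = some n) : Red a b :=
  fun u v d => .symm _ _ (.rel _ _ ⟨isLinkDiagram_congr d hab, d, u, v, b, a, h, rfl, rfl⟩)

theorem strandsAbove_pair {e f : Slice} {m n : ℕ} : strandsAbove m [e, f] = some n ↔
    e.pos + e.kind.inputs ≤ m ∧ f.pos + f.kind.inputs ≤ m - e.kind.inputs + e.kind.outputs ∧
      m - e.kind.inputs + e.kind.outputs - f.kind.inputs + f.kind.outputs = n := by
  simp only [strandsAbove, Option.bind_fun_some, Option.bind_eq_some_iff, Slice.apply_eq_some]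
  constructor
  · rintro ⟨k, ⟨h1, rfl⟩, h2, h3⟩
    exact ⟨h1, h2, h3⟩
  · rintro ⟨h1, h2, h3⟩
    exact ⟨_, ⟨h1, rfl⟩, h2, h3⟩

theorem strandsAbove_single {e : Slice} {m n : ℕ} : strandsAbove m [e] = some n ↔
    e.pos + e.kind.inputs ≤ m ∧ m - e.kind.inputs + e.kind.outputs = n := by
  simp only [strandsAbove, Option.bind_fun_some, Slice.apply_eq_some]

theorem red_zigzag_left (i : ℕ) : Red [cup (i + 1), cap i] [] :=
  .of_localMove (.zigzag_left i) fun m n h => by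
    rw [strandsAbove_pair] at h
    simp only [Kind.inputs, Kind.outputs] at h
    simp only [strandsAbove, Option.some.injEq]
    omega

theorem red_zigzag_right (i : ℕ) : Red [cup i, cap (i + 1)] [] :=
  .of_localMove (.zigzag_right i) fun m n h => by
    rw [strandsAbove_pair] at h
    simp only [Kind.inputs, Kind.outputs] at h
    simp only [strandsAbove, Option.some.injEq]
    omega

theorem red_slide_cup (s : Bool) (i : ℕ) :
    Red [cup (i + 1), cross s i] [cup i, cross (!s) (i + 1)] :=
  .of_localMove (.slide_cup s i) fun m n h => by
    rw [strandsAbove_pair] at h ⊢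
    simp only [Kind.inputs, Kind.outputs] at h ⊢
    omega

theorem red_slide_cup_symm (s : Bool) (i : ℕ) :
    Red [cup i, cross s (i + 1)] [cup (i + 1), cross (!s) i] := by
  have := LocalMove.slide_cup (!s) i
  rw [Bool.not_not] at this
  refine .of_localMove_symm this fun m n h => ?_
  rw [strandsAbove_pair] at h ⊢
  simp only [Kind.inputs, Kind.outputs] at h ⊢
  omega

theorem red_reidemeister_one_cap (s : Bool) (i : ℕ) : Red [cross s i, cap i] [cap i] :=
  .of_localMove (.reidemeister_one_cap s i) fun m n h => by
    rw [strandsAbove_pair] at h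
    rw [strandsAbove_single]
    simp only [Kind.inputs, Kind.outputs] at h ⊢
    omega

theorem red_reidemeister_one_cup (s : Bool) (i : ℕ) : Red [cup i, cross s i] [cup i] :=
  .of_localMove (.reidemeister_one_cup s i) fun m n h => by
    rw [strandsAbove_pair] at h
    rw [strandsAbove_single]
    simp only [Kind.inputs, Kind.outputs] at h ⊢
    omega

/-- Words that may be exchanged for each other in both directions without changing the state
sum. -/
structure Isotopic (a b : Word) : Prop where
  red : Red a b
  red_symm : Red b a
  eval_eq : ∀ v p, eval dualZeta (a ++ v) p = eval dualZeta (b ++ v) p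

theorem Isotopic.symm {a b : Word} (h : Isotopic a b) : Isotopic b a :=
  ⟨h.red_symm, h.red, fun v p => (h.eval_eq v p).symm⟩

theorem Isotopic.refl (a : Word) : Isotopic a a := ⟨.refl a, .refl a, fun _ _ => rfl⟩

theorem Isotopic.trans {a b c : Word} (h : Isotopic a b) (h' : Isotopic b c) : Isotopic a c :=
  ⟨h.red.trans h'.red, h'.red_symm.trans h.red_symm,
    fun v p => (h.eval_eq v p).trans (h'.eval_eq v p)⟩

theorem Isotopic.within {a b : Word} (h : Isotopic a b) (x y : Word) {w w' : Word}
    (e : w = x ++ a ++ y) (e' : w' = x ++ b ++ y) : Isotopic w w' := by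
  refine ⟨h.red.within x y e e', h.red_symm.within x y e' e, fun v p => ?_⟩
  subst e e'
  have := eval_append dualZeta (c := 1) (fun p => by simpa using h.eval_eq (y ++ v) p) x p
  simpa using this

theorem isotopic_exchange (k l : Kind) {i j : ℕ} (h : i ≤ j) :
    Isotopic [⟨k, i⟩, ⟨l, j + k.outputs⟩] [⟨l, j + k.inputs⟩, ⟨k, i⟩] := by
  have m := LocalMove.exchange k l i j h
  refine ⟨.of_localMove m fun m n h => ?_, .of_localMove_symm m fun m n h => ?_,
    fun v p => eval_exchange dualZeta k l h v p⟩ <;>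
  · rw [strandsAbove_pair] at h ⊢
    simp only at h ⊢
    omega

/-- Moves all slices of a word to the right. -/
def shift (n : ℕ) (w : Word) : Word := w.map fun e => ⟨e.kind, e.pos + n⟩

/-- A slice may be exchanged with a word on its right. -/
theorem isotopic_exchange_word (k : Kind) (i : ℕ) (a : Word) (h : ∀ e ∈ a, i ≤ e.pos) :
    Isotopic (⟨k, i⟩ :: shift k.outputs a) (shift k.inputs a ++ [⟨k, i⟩]) := by
  induction a with
  | nil => exact .refl _
  | cons e a ih =>
    refine Isotopic.trans ((isotopic_exchange k e.kind (h e (by simp))).within []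
      (shift k.outputs a) (by simp [shift]) rfl) ?_
    exact (ih fun e he => h e (by simp [he])).within [⟨e.kind, e.pos + k.inputs⟩] []
      (by simp) (by simp [shift])

/-! ### Rows of tangles -/

/-- A crossing or one of its two smoothings. -/
inductive Column
  | cross (s : Bool)
  | zero
  | infty

/-- The tangle of a column at a given position. -/
def Column.word : Column → ℕ → Word
  | .cross s, i => [QALink.cross s i]
  | .zero, _ => []
  | .infty, i => [cap i, cup i]

/-- Tangles next to each other, at every second position. -/
def columns : List Column → ℕ → Word
  | [], _ => []
  | X :: Xs, i => X.word i ++ columns Xs (i + 2)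

/-- Minima next to each other. -/
def cups (n i : ℕ) : Word := (List.range n).map fun k => cup (i + 2 * k)

/-- The horizontal composition of tangles. -/
def row (Xs : List Column) (i : ℕ) : Word :=
  cups (Xs.length - 1) (i + 1) ++ columns Xs i ++ List.replicate (Xs.length - 1) (cap (i + 1))

theorem cups_succ (n i : ℕ) : cups (n + 1) i = cup i :: cups n (i + 2) := by
  simp only [cups, List.range_succ_eq_map, List.map_cons, List.map_map]
  congr 1
  refine List.map_congr_left fun k _ => ?_
  simp only [Function.comp_apply]
  congr 1
  omega

theorem shift_cups (n i : ℕ) : shift 2 (cups n i) = cups n (i + 2) := by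
  simp only [cups, shift, List.map_map]
  refine List.map_congr_left fun k _ => ?_
  simp only [Function.comp_apply]
  congr 1
  omega

theorem shift_word (X : Column) (i : ℕ) : shift 2 (X.word i) = X.word (i + 2) := by
  cases X <;> rfl

theorem shift_append (n : ℕ) (v w : Word) : shift n (v ++ w) = shift n v ++ shift n w :=
  List.map_append

theorem shift_columns (Xs : List Column) (i : ℕ) :
    shift 2 (columns Xs i) = columns Xs (i + 2) := by
  induction Xs generalizing i with
  | nil => rfl
  | cons X Xs ih => rw [columns, columns, shift_append, shift_word, ih]

theorem shift_row (Xs : List Column) (i : ℕ) : shift 2 (row Xs i) = row Xs (i + 2) := by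
  simp only [row, shift_append, shift_columns, shift_cups]
  congr 1
  simp [shift]

theorem le_pos_cups {n i : ℕ} : ∀ e ∈ cups n i, i ≤ e.pos := by
  intro e he
  obtain ⟨k, -, rfl⟩ := List.mem_map.1 he
  simp

theorem le_pos_columns {Xs : List Column} {i : ℕ} : ∀ e ∈ columns Xs i, i ≤ e.pos := by
  induction Xs generalizing i with
  | nil => simp [columns]
  | cons X Xs ih =>
    intro e he
    rcases List.mem_append.1 he with he | he
    · cases X <;> simp [Column.word] at he <;> grind
    · have := ih e he
      omega

theorem le_pos_row {Xs : List Column} {i : ℕ} : ∀ e ∈ row Xs i, i ≤ e.pos := by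
  intro e he
  simp only [row, List.mem_append] at he
  rcases he with (he | he) | he
  · have := le_pos_cups e he
    omega
  · exact le_pos_columns e he
  · rw [List.eq_of_mem_replicate he]
    simp

theorem isotopic_word_shift (X : Column) (i : ℕ) (a : Word) (h : ∀ e ∈ a, i ≤ e.pos) :
    Isotopic (X.word i ++ shift 2 a) (shift 2 a ++ X.word i) := by
  rcases X with s | _ | _
  · exact isotopic_exchange_word (.cross s) i a h
  · simpa [Column.word] using Isotopic.refl _
  · have h1 := isotopic_exchange_word .cup i a h
    have h2 := isotopic_exchange_word .cap i a h
    have e : ∀ b : Word, shift 0 b = b := fun b => by simp [shift]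
    simp only [Kind.inputs, Kind.outputs, e] at h1 h2
    exact (h1.within [cap i] [] (by simp [Column.word]) rfl).trans
      (h2.within [] [cup i] (by simp) (by simp [Column.word]))

/-- The first tangle of a row can be split off. -/
theorem isotopic_row_cons (X : Column) {Xs : List Column} (h : Xs ≠ []) (i : ℕ) :
    Isotopic (row (X :: Xs) i)
      (cup (i + 1) :: (X.word i ++ row Xs (i + 2) ++ [cap (i + 1)])) := by
  obtain ⟨Y, Xs, rfl⟩ := List.exists_cons_of_ne_nil h
  have e : ∀ b : Word, shift 0 b = b := fun b => by simp [shift]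
  have h1 := isotopic_word_shift X i (cups Xs.length (i + 1)) fun e he => by
    have := le_pos_cups e he
    omega
  have h2 := isotopic_exchange_word .cap (i + 1) (List.replicate Xs.length (cap (i + 1)))
    fun e he => by rw [List.eq_of_mem_replicate he]
  rw [shift_cups] at h1
  simp only [Kind.inputs, Kind.outputs, e] at h2
  refine (h1.symm.within [cup (i + 1)] (columns (Y :: Xs) (i + 2) ++
    List.replicate (Xs.length + 1) (cap (i + 1))) ?_ rfl).trans
    (h2.within ([cup (i + 1)] ++ (X.word i ++ cups Xs.length (i + 1 + 2)) ++
      columns (Y :: Xs) (i + 2)) [] ?_ ?_)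
  · simp [row, columns, cups_succ]
  · simp [List.replicate_succ]
  · simp [row, columns, shift]

theorem isotopic_cup_row (i : ℕ) (Xs : List Column) :
    Isotopic (cup i :: row Xs (i + 2)) (row Xs i ++ [cup i]) := by
  have := isotopic_exchange_word .cup i (row Xs i) le_pos_row
  have e : ∀ b : Word, shift 0 b = b := fun b => by simp [shift]
  simpa only [Kind.inputs, Kind.outputs, e, shift_row] using this

/-- A row of crossings whose left ends are closed up is unknotted. -/
theorem red_row_closed (s : Bool) (n i : ℕ) :
    Red (cup (i + 1) :: (row (List.replicate (n + 1) (.cross s)) (i + 2) ++ [cap (i + 1)])) [] := by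
  induction n with
  | zero =>
    have e : row (List.replicate (0 + 1) (.cross s)) (i + 2) = [cross s (i + 2)] := rfl
    rw [e]
    -- Sliding the crossing across the minimum turns it into a kink at the closing maximum; once
    -- that is removed, a zigzag is left.
    refine Red.trans ((red_slide_cup_symm s (i + 1)).within [] [cap (i + 1)] rfl rfl) ?_
    exact Red.trans ((red_reidemeister_one_cap (!s) (i + 1)).within [cup (i + 2)] [] rfl rfl)
      (red_zigzag_left (i + 1))
  | succ n ih =>
    set Xs := List.replicate (n + 1) (Column.cross s) with hXs
    have hX : Xs ≠ [] := by simp [hXs]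
    have e : List.replicate (n + 1 + 1) (Column.cross s) = .cross s :: Xs := rfl
    rw [e]
    refine Red.trans ((isotopic_row_cons (.cross s) hX (i + 2)).red.within [cup (i + 1)]
      [cap (i + 1)] (by simp) rfl) ?_
    refine Red.trans ((isotopic_exchange .cup .cup (le_refl (i + 1))).red.within []
      (cross s (i + 2) :: (row Xs (i + 4) ++ [cap (i + 3), cap (i + 1)]))
      (by simp [Column.word, Kind.outputs]) rfl) ?_
    refine Red.trans ((red_slide_cup_symm s (i + 1)).within [cup (i + 1)]
      (row Xs (i + 4) ++ [cap (i + 3), cap (i + 1)]) (by simp [Kind.inputs]) rfl) ?_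
    -- After the slide the first crossing lies to the left of the rest of the row, so it can rise to
    -- the last maximum, where it is a kink.
    have h1 := isotopic_exchange_word (.cross (!s)) (i + 1) (row Xs (i + 2) ++ [cap (i + 1)])
      fun e he => by
        rcases List.mem_append.1 he with he | he
        · have := le_pos_row e he
          omega
        · simp only [List.mem_singleton] at he
          simp [he]
    rw [Kind.inputs, Kind.outputs, shift_append, shift_row] at h1
    refine Red.trans (h1.red.within [cup (i + 1), cup (i + 2)] [cap (i + 1)]
      (by simp [shift]) rfl) ?_
    refine Red.trans ((red_reidemeister_one_cap (!s) (i + 1)).within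
      ([cup (i + 1), cup (i + 2)] ++ row Xs (i + 4) ++ [cap (i + 3)]) []
      (by simp [shift]) rfl) ?_
    refine Red.trans ((isotopic_cup_row (i + 2) Xs).red.within [cup (i + 1)]
      [cap (i + 3), cap (i + 1)] (by simp) rfl) ?_
    exact Red.trans ((red_zigzag_right (i + 2)).within (cup (i + 1) :: row Xs (i + 2))
      [cap (i + 1)] (by simp) (by simp)) ih

/-- A row of crossings, one of which is smoothed vertically. -/
theorem red_row_zero (s : Bool) (r q i : ℕ) :
    Red (row (List.replicate r (.cross s) ++ .zero :: List.replicate q (.cross s)) i) [] := by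
  induction r generalizing i with
  | zero =>
    rcases q with _ | q
    · exact Red.refl _
    · refine Red.trans (isotopic_row_cons .zero (by simp) i).red ?_
      simpa [Column.word] using red_row_closed s q i
  | succ r ih =>
    refine Red.trans (isotopic_row_cons (.cross s) (by simp) i).red ?_
    refine Red.trans ((ih (i + 2)).within [cup (i + 1), cross s i] [cap (i + 1)]
      (by simp [Column.word]) rfl) ?_
    -- The rest of the row is now two vertical strands, so the right ends of the remaining crossing
    -- are joined and it is a kink.
    refine Red.trans ((red_slide_cup s i).within [] [cap (i + 1)] rfl rfl) ?_
    exact Red.trans ((red_reidemeister_one_cap (!s) (i + 1)).within [cup i] [] rfl rfl)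
      (red_zigzag_right i)

/-- A row of crossings, one of which is smoothed horizontally. -/
theorem red_row_infty (s : Bool) (r q i : ℕ) (h : r + q ≠ 0) :
    Red (row (List.replicate r (.cross s) ++ .infty :: List.replicate q (.cross s)) i)
      (row (List.replicate (r + q) (.cross s)) i) := by
  induction r generalizing i with
  | zero =>
    have hq : List.replicate q (Column.cross s) ≠ [] := by
      simp only [ne_eq, List.replicate_eq_nil_iff]
      omega
    rw [Nat.zero_add]
    refine Red.trans (isotopic_row_cons .infty hq i).red ?_
    refine Red.trans ((red_zigzag_left i).within []
      (cup i :: (row (List.replicate q (.cross s)) (i + 2) ++ [cap (i + 1)]))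
      (by simp [Column.word]) rfl) ?_
    refine Red.trans ((isotopic_cup_row i (List.replicate q (.cross s))).red.within []
      [cap (i + 1)] (by simp) rfl) ?_
    exact (red_zigzag_right i).within (row (List.replicate q (.cross s)) i) [] (by simp) (by simp)
  | succ r ih =>
    refine Red.trans (isotopic_row_cons (.cross s) (by simp) i).red ?_
    -- The induction hypothesis is not available here: `row []` is two vertical strands, while a
    -- single horizontally smoothed column is a maximum below a minimum.
    by_cases hr : r + q = 0
    · obtain ⟨rfl, rfl⟩ : r = 0 ∧ q = 0 := by omega
      refine Red.trans ((red_zigzag_left (i + 1)).within [cup (i + 1), cross s i, cap (i + 2)] []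
        rfl rfl) ?_
      refine Red.trans ((isotopic_exchange (.cross s) .cap (le_refl i)).red.within [cup (i + 1)] []
        rfl rfl) ?_
      exact (red_zigzag_right (i + 1)).within [] [cross s i] rfl rfl
    · refine Red.trans ((ih (i + 2) hr).within [cup (i + 1), cross s i] [cap (i + 1)]
        (by simp [Column.word]) rfl) ?_
      have e : List.replicate (r + 1 + q) (Column.cross s) =
          .cross s :: List.replicate (r + q) (.cross s) := by
        rw [show r + 1 + q = r + q + 1 by omega, List.replicate_succ]
      rw [e]
      have := (isotopic_row_cons (.cross s) (Xs := List.replicate (r + q) (.cross s))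
        (by simpa using hr) i).red_symm
      simpa [Column.word] using this

/-- A stack of crossings, one of which is smoothed horizontally. -/
theorem red_stack_infty (s : Bool) (r q i : ℕ) :
    Red (List.replicate r (cross s i) ++ [cap i, cup i] ++ List.replicate q (cross s i))
      [cap i, cup i] := by
  induction r with
  | zero =>
    induction q with
    | zero => exact Red.refl _
    | succ q ih =>
      exact Red.trans ((red_reidemeister_one_cup s i).within [cap i]
        (List.replicate q (cross s i)) (by simp [List.replicate_succ]) rfl) (by simpa using ih)
  | succ r ih =>
    refine Red.trans (ih.within [cross s i] [] (by simp [List.replicate_succ]) rfl) ?_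
    exact (red_reidemeister_one_cap s i).within [] [cup i] rfl rfl

/-! ### State sums of twists -/

open TrivSqZeroExt Matching

/-- The complex weight of the vertical smoothing of a crossing. -/
noncomputable def zetaTurn (s : Bool) : ℂ := (turn dualZeta s : DualNumber ℂ).fst

theorem fst_turn_inv (s : Bool) :
    (((turn dualZeta s)⁻¹ : (DualNumber ℂ)ˣ) : DualNumber ℂ).fst = (zetaTurn s)⁻¹ := by
  cases s <;> simp [zetaTurn, turn, dualZeta]

/-- Below a stack, a horizontally smoothed crossing contributes a loop for each further horizontal
smoothing. Modulo `ε` at most one crossing is smoothed horizontally, in `n` ways, each of weight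
`zⁿ⁻²`. -/
theorem eval_stack (s : Bool) (n : ℕ) : ∃ x y : DualNumber ℂ,
    x.fst = zetaTurn s ^ n ∧ y.fst = n * zetaTurn s ^ n * (zetaTurn s)⁻¹ ^ 2 ∧
    ∀ i v p, eval dualZeta (List.replicate n (cross s i) ++ v) p =
      x * eval dualZeta v p + y * eval dualZeta ([cap i, cup i] ++ v) p := by
  have hz : zetaTurn s ≠ 0 := by
    rw [← norm_ne_zero_iff, zetaTurn, norm_fst_turn]
    exact one_ne_zero
  induction n with
  | zero => exact ⟨1, 0, by simp, by simp, fun i v p => by simp⟩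
  | succ n ih =>
    obtain ⟨x, y, hx, hy, h⟩ := ih
    refine ⟨turn dualZeta s * x, turn dualZeta s * y + ((turn dualZeta s)⁻¹ : (DualNumber ℂ)ˣ) * x +
      ((turn dualZeta s)⁻¹ : (DualNumber ℂ)ˣ) * loopValue dualZeta * y, ?_, ?_, fun i v p => ?_⟩
    · rw [fst_mul, hx, pow_succ', zetaTurn]
    · simp only [fst_add, fst_mul, loopValue_dualZeta, DualNumber.fst_eps, fst_turn_inv, hx, hy]
      rw [← zetaTurn]
      push_cast
      field_simp
      ring
    · rw [List.replicate_succ, List.cons_append, eval, h, h]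
      simp only [List.cons_append, List.nil_append, eval, capWeight_addCup_self,
        addCap_addCup_self]
      ring

/-- The dual count: modulo `ε` at most one column is smoothed vertically. In the recursion a
vertically smoothed first column closes the left ends of the remaining row, and a horizontally
smoothed one leaves that row unchanged. -/
theorem eval_row (s : Bool) (n : ℕ) : ∃ x y : DualNumber ℂ,
    x.fst = (n + 1 : ℕ) * zetaTurn s ^ 2 * (zetaTurn s)⁻¹ ^ (n + 1) ∧
    y.fst = (zetaTurn s)⁻¹ ^ (n + 1) ∧
    ∀ i v p, eval dualZeta (row (List.replicate (n + 1) (.cross s)) i ++ v) p =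
      x * eval dualZeta v p + y * eval dualZeta ([cap i, cup i] ++ v) p := by
  have hz : zetaTurn s ≠ 0 := by
    rw [← norm_ne_zero_iff, zetaTurn, norm_fst_turn]
    exact one_ne_zero
  induction n with
  | zero =>
    refine ⟨turn dualZeta s, ((turn dualZeta s)⁻¹ : (DualNumber ℂ)ˣ), ?_, ?_, fun i v p => ?_⟩
    · rw [← zetaTurn]
      push_cast
      linear_combination -zetaTurn s * mul_inv_cancel₀ hz
    · rw [fst_turn_inv, zero_add, pow_one]
    · rfl
  | succ n ih =>
    obtain ⟨x, y, hx, hy, h⟩ := ih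
    refine ⟨x * (turn dualZeta s * loopValue dualZeta + ((turn dualZeta s)⁻¹ : (DualNumber ℂ)ˣ)) +
      y * turn dualZeta s, ((turn dualZeta s)⁻¹ : (DualNumber ℂ)ˣ) * y, ?_, ?_, fun i v p => ?_⟩
    · simp only [fst_add, fst_mul, loopValue_dualZeta, DualNumber.fst_eps, fst_turn_inv, hx, hy]
      rw [← zetaTurn]
      push_cast
      linear_combination -zetaTurn s * (zetaTurn s)⁻¹ ^ (n + 1) * mul_inv_cancel₀ hz
    · rw [fst_mul, fst_turn_inv, hy, ← pow_succ']
    · have hs : List.replicate (n + 1 + 1) (Column.cross s) =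
        .cross s :: List.replicate (n + 1) (.cross s) := rfl
      rw [hs, (isotopic_row_cons (.cross s) (by simp) i).eval_eq]
      have e := eval_append₂ dualZeta (h (i + 2) (cap (i + 1) :: v)) [cup (i + 1), cross s i] p
      have c1 := fun q => capWeight_succ_addCup dualZeta (i + 1) q
      have c2 := fun q => capWeight_addCup_succ dualZeta (i + 1) q
      have c3 := fun q => addCap_addCup_right (i + 1) q
      have c4 := fun q => addCap_addCup_left (i + 1) q
      have c5 := fun q => capWeight_addCup_of_le dualZeta (le_refl i) q
      have c6 := fun q => addCap_addCup_of_le i i le_rfl q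
      simp only [Nat.reduceAdd, Nat.add_assoc] at c1 c2 c3 c4
      simp only [Column.word, List.cons_append, List.nil_append, List.append_assoc] at e ⊢
      rw [e]
      simp only [eval, capWeight_addCup_self, addCap_addCup_self, capWeight_addCup_succ,
        capWeight_succ_addCup, addCap_addCup_left, addCap_addCup_right, c1, c2, c3, c4, c5, c6]
      ring

/-! ### Determinants of twists -/

/-- Equality in the triangle inequality puts `z⁻¹x` and `zy` on a common ray. -/
theorem eq_of_norm_add {x y z : ℂ} (hz : ‖z‖ = 1) (hx : x ≠ 0)
    (h : ‖z⁻¹ * x + z * y‖ = ‖x‖ + ‖y‖) : y = (‖y‖ / ‖x‖ : ℝ) * z⁻¹ ^ 2 * x := by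
  have hz0 : z ≠ 0 := norm_ne_zero_iff.1 (by rw [hz]; exact one_ne_zero)
  have h1 : ‖z⁻¹ * x‖ = ‖x‖ := by rw [norm_mul, norm_inv, hz, inv_one, one_mul]
  have h2 : ‖z * y‖ = ‖y‖ := by rw [norm_mul, hz, one_mul]
  have key := sameRay_iff_norm_smul_eq.1
    (sameRay_iff_norm_add.2 (show ‖z⁻¹ * x + z * y‖ = ‖z⁻¹ * x‖ + ‖z * y‖ by rw [h, h1, h2]))
  rw [h1, h2, Complex.real_smul, Complex.real_smul] at key
  have hx' : (‖x‖ : ℂ) ≠ 0 := by exact_mod_cast norm_ne_zero_iff.2 hx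
  push_cast
  field_simp
  field_simp at key
  linear_combination key

/-- Substituting for `y` produces the factor `z⁻⁴ = -1`, so what was a sum for the original crossing
becomes a difference for the opposite twists. -/
theorem norm_stack {x y z : ℂ} (hz : ‖z‖ = 1) (hz4 : z ^ 4 = -1) (hx : x ≠ 0)
    (h : ‖z⁻¹ * x + z * y‖ = ‖x‖ + ‖y‖) (n : ℕ) :
    ‖z ^ n * x + n * z ^ n * z⁻¹ ^ 2 * y‖ = |‖x‖ - n * ‖y‖| := by
  have hx' := norm_ne_zero_iff.2 hx
  have e := eq_of_norm_add hz hx h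
  have h4 : z⁻¹ ^ 4 = -1 := by rw [inv_pow, hz4]; norm_num
  have : z ^ n * x + n * z ^ n * z⁻¹ ^ 2 * y =
      z ^ n * x * (1 - n * (‖y‖ / ‖x‖) : ℝ) := by
    rw (occs := [1]) [e]
    push_cast
    linear_combination (n * z ^ n * (‖y‖ / ‖x‖) * x : ℂ) * h4
  rw [this, norm_mul, norm_mul, norm_pow, hz, one_pow, one_mul, Complex.norm_real, Real.norm_eq_abs,
    ← abs_of_nonneg (norm_nonneg x), ← abs_mul, abs_of_nonneg (norm_nonneg x)]
  congr 1
  field_simp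

theorem norm_row {x y z : ℂ} (hz : ‖z‖ = 1) (hz4 : z ^ 4 = -1) (hx : x ≠ 0)
    (h : ‖z⁻¹ * x + z * y‖ = ‖x‖ + ‖y‖) (n : ℕ) :
    ‖n * z ^ 2 * z⁻¹ ^ n * x + z⁻¹ ^ n * y‖ = |n * ‖x‖ - ‖y‖| := by
  have hz0 : z ≠ 0 := norm_ne_zero_iff.1 (by rw [hz]; exact one_ne_zero)
  have hx' := norm_ne_zero_iff.2 hx
  have e := eq_of_norm_add hz hx h
  have h2 : z⁻¹ ^ 2 = -z ^ 2 := by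
    field_simp
    linear_combination hz4
  have : n * z ^ 2 * z⁻¹ ^ n * x + z⁻¹ ^ n * y =
      z⁻¹ ^ n * z ^ 2 * x * (n - ‖y‖ / ‖x‖ : ℝ) := by
    rw (occs := [1]) [e]
    push_cast
    linear_combination (z⁻¹ ^ n * (‖y‖ / ‖x‖) * x : ℂ) * h2
  rw [this, norm_mul, norm_mul, norm_mul, norm_pow, norm_pow, norm_inv, hz, inv_one, one_pow,
    one_pow, one_mul, one_mul, Complex.norm_real, Real.norm_eq_abs,
    ← abs_of_nonneg (norm_nonneg x), ← abs_mul, abs_of_nonneg (norm_nonneg x)]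
  congr 1
  field_simp

theorem norm_zetaTurn (s : Bool) : ‖zetaTurn s‖ = 1 := norm_fst_turn s

theorem zetaTurn_not (s : Bool) : zetaTurn s = (zetaTurn (!s))⁻¹ := by
  cases s <;> simp [zetaTurn, turn, dualZeta]

theorem zetaTurn_pow_four (s : Bool) : zetaTurn s ^ 4 = -1 := by
  have := zeta_pow_four
  cases s
  · simp only [zetaTurn, turn, dualZeta]
    simp [this]
  · simp only [zetaTurn, turn, dualZeta]
    simp [this]

namespace MarkedCrossing

/-- The bracket of a diagram in which a crossing is replaced by a tangle whose state sum is a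
combination of those of the two smoothings. -/
theorem bracket_replace {c : MarkedCrossing} (h0 : QuasiAlternating c.smoothZero)
    (h1 : QuasiAlternating c.smoothInfty) {T : Word} {x y : DualNumber ℂ}
    (hT : IsLinkDiagram (c.replace T))
    (h : ∀ v p, eval dualZeta (T ++ v) p =
      x * eval dualZeta v p + y * eval dualZeta ([cap c.pos, cup c.pos] ++ v) p) :
    bracket zeta (c.replace T) =
      x.fst * bracket zeta c.smoothZero + y.fst * bracket zeta c.smoothInfty := by
  obtain ⟨d0, n0⟩ := h0.isLinkDiagram
  obtain ⟨d1, n1⟩ := h1.isLinkDiagram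
  have hn : c.replace T ≠ [] := by
    intro e
    simp only [replace, List.append_eq_nil_iff] at e
    exact n0 (by simp [smoothZero, replace, e])
  have e := eval_append₂ dualZeta (h c.above) c.below Matching.standard
  rw [← List.append_assoc, ← List.append_assoc] at e
  rw [bracket_zeta_eq hT hn]
  change (eval dualZeta (c.below ++ T ++ c.above) _).snd = _
  have e0 : c.below ++ c.above = c.smoothZero := by simp [smoothZero, replace]
  rw [e, e0]
  change (_ + y * eval dualZeta c.smoothInfty _).snd = _
  rw [eval_dualZeta d0 n0, eval_dualZeta d1 n1]
  simp [mul_comm]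

/-- The relation between the brackets of the smoothings of a quasi-alternating crossing. -/
theorem IsQuasiAlternating.norm_add {c : MarkedCrossing} (hc : c.IsQuasiAlternating) :
    ‖(zetaTurn (!c.sign))⁻¹ * bracket zeta c.smoothZero +
      zetaTurn (!c.sign) * bracket zeta c.smoothInfty‖ =
    ‖bracket zeta c.smoothZero‖ + ‖bracket zeta c.smoothInfty‖ := by
  obtain ⟨hd, h0, h1, -, -, h⟩ := hc
  have := bracket_replace h0 h1 (T := [cross c.sign c.pos]) (x := turn dualZeta c.sign)
    (y := ((turn dualZeta c.sign)⁻¹ : (DualNumber ℂ)ˣ)) hd fun v p => rfl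
  rw [fst_turn_inv, ← zetaTurn, zetaTurn_not, inv_inv] at this
  rw [← this]
  exact h

theorem IsQuasiAlternating.bracket_ne_zero {c : MarkedCrossing} (hc : c.IsQuasiAlternating) :
    bracket zeta c.smoothZero ≠ 0 := by
  have := hc.2.1.one_le_det
  rw [det_eq] at this
  exact norm_ne_zero_iff.1 (by linarith)

theorem IsQuasiAlternating.exists_strands {c : MarkedCrossing} (hc : c.IsQuasiAlternating) :
    ∃ m, c.pos + 2 ≤ m ∧ strandsAbove 0 c.below = some m ∧ strandsAbove m c.above = some 0 := by
  obtain ⟨m, n, h1, h2, h3⟩ := isLinkDiagram_replace hc.1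
  rw [strandsAbove_single] at h2
  simp only [Kind.inputs, Kind.outputs] at h2
  obtain rfl : m = n := by omega
  exact ⟨m, h2.1, h1, h3⟩

/-! ### Vertical opposite twists -/

theorem strandsAbove_verticalTwists (s : Bool) (n : ℕ) {m i : ℕ} (h : i + 2 ≤ m) :
    strandsAbove m (verticalTwists n s i) = some m := by
  induction n with
  | zero => rfl
  | succ n ih =>
    refine Option.bind_eq_some_iff.2 ⟨m, Slice.apply_eq_some.2 ⟨h, ?_⟩, ih⟩
    simp only [Kind.inputs, Kind.outputs]
    omega

theorem isLinkDiagram_stack {c : MarkedCrossing} (hc : c.IsQuasiAlternating) (s : Bool) (n : ℕ) :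
    IsLinkDiagram (c.replace (verticalTwists n s c.pos)) := by
  obtain ⟨m, hm, h1, h2⟩ := hc.exists_strands
  exact isLinkDiagram_of_strandsAbove h1 (strandsAbove_verticalTwists s n hm) h2

theorem det_stack {c : MarkedCrossing} (hc : c.IsQuasiAlternating) (n : ℕ) :
    det (c.replace (c.verticalOppositeTwists n)) = |det c.smoothZero - n * det c.smoothInfty| := by
  obtain ⟨x, y, hx, hy, h⟩ := eval_stack (!c.sign) n
  have := bracket_replace hc.2.1 hc.2.2.1 (isLinkDiagram_stack hc (!c.sign) n) (h c.pos)
  rw [det_eq, det_eq, det_eq, verticalOppositeTwists, this, hx, hy]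
  exact norm_stack (norm_zetaTurn _) (zetaTurn_pow_four _) hc.bracket_ne_zero hc.norm_add n

theorem IsQuasiAlternating.diagram {c : MarkedCrossing} (hc : c.IsQuasiAlternating) :
    QuasiAlternating c.diagram := .crossing c hc.1 hc.2.1 hc.2.2.1 hc.2.2.2

/-- A crossing of a stack of twists is quasi-alternating. -/
theorem isQuasiAlternating_stack {c : MarkedCrossing} (hc : c.IsQuasiAlternating) {n : ℕ}
    (hn : 1 ≤ n) (hdet : det c.smoothZero < det c.smoothInfty)
    (hq : QuasiAlternating (c.replace (c.verticalOppositeTwists n))) {c' : MarkedCrossing}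
    (h : c.IsNewCrossing (c.verticalOppositeTwists (n + 1)) c') :
    c'.IsQuasiAlternating ∧ c'.diagram = c.replace (c.verticalOppositeTwists (n + 1)) := by
  obtain ⟨p, q, hT, hb, ha⟩ := h
  have hdiag : c'.diagram = c.replace (c.verticalOppositeTwists (n + 1)) := by
    rw [hT, MarkedCrossing.diagram, replace, replace, hb, ha]
    simp
  have hT' := hT.symm
  rw [verticalOppositeTwists, verticalTwists, List.append_eq_replicate_iff,
    List.append_eq_replicate_iff] at hT'
  obtain ⟨hl, ⟨-, hp, hx⟩, hq'⟩ := hT'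
  simp only [List.length_append, List.length_singleton, List.replicate_one, List.cons.injEq,
    and_true, Slice.mk.injEq, Kind.cross.injEq] at hl hx
  obtain ⟨hs, hpos⟩ := hx
  have hzero : c'.smoothZero = c.replace (c.verticalOppositeTwists n) := by
    have : List.replicate n (cross (!c.sign) c.pos) = p ++ q := by
      rw [hp, hq', List.replicate_append_replicate]
      congr 1
      omega
    rw [smoothZero, replace, replace, verticalOppositeTwists, verticalTwists, hb, ha, this]
    simp
  have hinfty : DiagramEquiv c'.smoothInfty c.smoothInfty := by
    have r := red_stack_infty (!c.sign) p.length q.length c.pos c.below c.above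
    rw [← hp, ← hq'] at r
    have e : c'.smoothInfty = c.below ++ (p ++ [cap c.pos, cup c.pos] ++ q) ++ c.above := by
      simp [smoothInfty, replace, hb, ha, hpos]
    rw [e]
    refine r ?_
    obtain ⟨m, hm, h1, h2⟩ := hc.exists_strands
    refine isLinkDiagram_of_strandsAbove h1 ?_ h2
    have e1 := fun k => strandsAbove_verticalTwists (!c.sign) k hm
    have e2 : strandsAbove m [cap c.pos, cup c.pos] = some m := by
      rw [strandsAbove_pair]
      simp only [Kind.inputs, Kind.outputs]
      omega
    rw [hp, hq', strandsAbove_append, strandsAbove_append]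
    simp only [verticalTwists] at e1
    rw [e1, Option.bind_some, e2, Option.bind_some, e1]
  -- Since `n ≥ 1` and `det L_0 < det L_∞`, the absolute value opens as `n det L_∞ - det L_0`; the
  -- same holds for `n + 1`, and the two differ by `det L_∞`.
  have hd0 : det c'.smoothZero = n * det c.smoothInfty - det c.smoothZero := by
    rw [hzero, det_stack hc, abs_sub_comm, abs_of_nonneg]
    have h1 : (1 : ℝ) ≤ n := by exact_mod_cast hn
    have := hc.2.2.1.one_le_det
    nlinarith
  have hd1 : det c'.smoothInfty = det c.smoothInfty := hinfty.det_eq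
  have hd : det c'.diagram = (n + 1) * det c.smoothInfty - det c.smoothZero := by
    rw [hdiag, det_stack hc, abs_sub_comm, abs_of_nonneg]
    · push_cast
      rfl
    · have h1 : (1 : ℝ) ≤ n := by exact_mod_cast hn
      have := hc.2.2.1.one_le_det
      push_cast
      nlinarith
  have q0 : QuasiAlternating c'.smoothZero := hzero ▸ hq
  have q1 : QuasiAlternating c'.smoothInfty := .equiv _ _ (.symm _ _ hinfty) hc.2.2.1
  refine ⟨⟨?_, q0, q1, q0.one_le_det, q1.one_le_det, by rw [hd, hd0, hd1]; ring⟩, hdiag⟩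
  rw [hdiag]
  exact isLinkDiagram_stack hc (!c.sign) (n + 1)

/-- A single opposite twist is the switched crossing, so property (I) starts the induction; the
inductive step resolves the lowest crossing. -/
theorem quasiAlternating_stack {c : MarkedCrossing} (hc : c.IsQuasiAlternating)
    (hI : c.PropertyI) (hdet : det c.smoothZero < det c.smoothInfty) {n : ℕ} (hn : 1 ≤ n) :
    QuasiAlternating (c.replace (c.verticalOppositeTwists n)) := by
  induction n, hn using Nat.le_induction with
  | base => exact hI
  | succ n hn ih =>
    obtain ⟨h1, h2⟩ := isQuasiAlternating_stack hc hn hdet ih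
      (c' := ⟨c.below, !c.sign, c.pos, verticalTwists n (!c.sign) c.pos ++ c.above⟩)
      ⟨[], verticalTwists n (!c.sign) c.pos, rfl, by simp, rfl⟩
    exact h2 ▸ h1.diagram

/-! ### Horizontal opposite twists -/

theorem strandsAbove_cups {m n i : ℕ} (h : i ≤ m) :
    strandsAbove m (cups n i) = some (m + 2 * n) := by
  induction n generalizing m i with
  | zero => rfl
  | succ n ih =>
    rw [cups_succ]
    refine Option.bind_eq_some_iff.2 ⟨m + 2, Slice.apply_eq_some.2 ⟨h, rfl⟩, ?_⟩
    rw [ih (by omega)]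
    congr 1
    omega

theorem strandsAbove_columns {m i : ℕ} {Xs : List Column} (h : i + 2 * Xs.length ≤ m) :
    strandsAbove m (columns Xs i) = some m := by
  induction Xs generalizing i with
  | nil => rfl
  | cons X Xs ih =>
    rw [List.length_cons] at h
    rw [columns, strandsAbove_append]
    refine Option.bind_eq_some_iff.2 ⟨m, ?_, ih (by omega)⟩
    rcases X with s | _ | _
    · rw [Column.word, strandsAbove_single]
      simp only [Kind.inputs, Kind.outputs]
      omega
    · rfl
    · rw [Column.word, strandsAbove_pair]
      simp only [Kind.inputs, Kind.outputs]
      omega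

theorem strandsAbove_caps {m n i : ℕ} (h : i ≤ m) :
    strandsAbove (m + 2 * n) (List.replicate n (cap i)) = some m := by
  induction n with
  | zero => rfl
  | succ n ih =>
    refine Option.bind_eq_some_iff.2 ⟨m + 2 * n, Slice.apply_eq_some.2 ⟨?_, rfl⟩, ih⟩
    simp only [Kind.inputs]
    omega

theorem isLinkDiagram_row {c : MarkedCrossing} (hc : c.IsQuasiAlternating) (Xs : List Column) :
    IsLinkDiagram (c.replace (row Xs c.pos)) := by
  obtain ⟨m, hm, h1, h2⟩ := hc.exists_strands
  refine isLinkDiagram_of_strandsAbove h1 ?_ h2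
  rw [row, strandsAbove_append, strandsAbove_append, strandsAbove_cups (by omega),
    Option.bind_some, strandsAbove_columns (by omega), Option.bind_some,
    strandsAbove_caps (by omega)]

theorem columns_replicate (s : Bool) (n i : ℕ) : columns (List.replicate n (.cross s)) i =
    (List.range n).map fun k => cross s (i + 2 * k) := by
  induction n generalizing i with
  | zero => rfl
  | succ n ih =>
    rw [List.replicate_succ, columns, ih, List.range_succ_eq_map, List.map_cons, List.map_map]
    refine congrArg (cross s i :: ·) (List.map_congr_left fun k _ => ?_)
    simp only [Function.comp_apply]
    congr 1
    omega

theorem horizontalTwists_eq_row (s : Bool) (n i : ℕ) :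
    horizontalTwists n s i = row (List.replicate n (.cross s)) i := by
  simp only [horizontalTwists, row, columns_replicate, List.length_replicate]
  rfl

theorem columns_append (Xs Ys : List Column) (i : ℕ) :
    columns (Xs ++ Ys) i = columns Xs i ++ columns Ys (i + 2 * Xs.length) := by
  induction Xs generalizing i with
  | nil => rfl
  | cons X Xs ih =>
    rw [List.cons_append, columns, columns, ih, List.append_assoc, List.length_cons,
      show i + 2 + 2 * Xs.length = i + 2 * (Xs.length + 1) by omega]

/-- Applied to a row, whose outer parts consist of minima and maxima only: a marked crossing has to
lie in the middle part. -/
theorem append_eq_append_of_notMem {α : Type*} {A B C p q : List α} {x : α} (hA : x ∉ A)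
    (hC : x ∉ C) (h : A ++ B ++ C = p ++ [x] ++ q) :
    ∃ B₁ B₂, B = B₁ ++ [x] ++ B₂ ∧ p = A ++ B₁ ∧ q = B₂ ++ C := by
  induction A generalizing p with
  | cons a A ih =>
    rcases p with _ | ⟨b, p⟩
    · simp only [List.cons_append, List.nil_append, List.cons.injEq] at h
      exact absurd (by simp [h.1]) hA
    · simp only [List.cons_append, List.cons.injEq] at h
      obtain ⟨rfl, h⟩ := h
      obtain ⟨B₁, B₂, h1, h2, h3⟩ := ih (fun h' => hA (by simp [h'])) h
      exact ⟨B₁, B₂, h1, by simp [h2], h3⟩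
  | nil =>
    rw [List.nil_append] at h
    induction B generalizing p with
    | nil =>
      exact absurd (by simp only [List.nil_append] at h; simp [h]) hC
    | cons b B ih =>
      rcases p with _ | ⟨a, p⟩
      · simp only [List.cons_append, List.nil_append, List.cons.injEq] at h
        obtain ⟨rfl, h⟩ := h
        exact ⟨[], B, rfl, rfl, h.symm⟩
      · simp only [List.cons_append, List.cons.injEq] at h
        obtain ⟨rfl, h⟩ := h
        obtain ⟨B₁, B₂, h1, h2, h3⟩ := ih h
        exact ⟨b :: B₁, B₂, by simp [h1], by simpa using h2, h3⟩

theorem columns_replicate_eq_append {s t : Bool} {n i j : ℕ} {p q : Word}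
    (h : columns (List.replicate n (.cross s)) i = p ++ [cross t j] ++ q) :
    ∃ r k, n = r + k + 1 ∧ t = s ∧ j = i + 2 * r ∧ p = columns (List.replicate r (.cross s)) i ∧
      q = columns (List.replicate k (.cross s)) (j + 2) := by
  induction n generalizing i p with
  | zero => simp [columns] at h
  | succ n ih =>
    rw [List.replicate_succ, columns] at h
    rcases p with _ | ⟨e, p⟩
    · simp only [Column.word, List.cons_append, List.nil_append, List.cons.injEq, Slice.mk.injEq,
        Kind.cross.injEq] at h
      obtain ⟨⟨rfl, rfl⟩, rfl⟩ := h
      exact ⟨0, n, by omega, rfl, rfl, rfl, rfl⟩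
    · simp only [Column.word, List.cons_append, List.nil_append, List.cons.injEq] at h
      obtain ⟨rfl, h⟩ := h
      obtain ⟨r, k, h1, h2, h3, h4, h5⟩ := ih (by simpa using h)
      exact ⟨r + 1, k, by omega, h2, by omega, by rw [h4]; rfl, h5⟩

theorem det_row {c : MarkedCrossing} (hc : c.IsQuasiAlternating) {n : ℕ} (hn : 1 ≤ n) :
    det (c.replace (row (List.replicate n (.cross (!c.sign))) c.pos)) =
      |n * det c.smoothZero - det c.smoothInfty| := by
  obtain ⟨n, rfl⟩ := Nat.exists_eq_add_of_le' hn
  obtain ⟨x, y, hx, hy, h⟩ := eval_row (!c.sign) n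
  have := bracket_replace hc.2.1 hc.2.2.1 (isLinkDiagram_row hc _) (h c.pos)
  rw [det_eq, det_eq, det_eq, this, hx, hy]
  exact norm_row (norm_zetaTurn _) (zetaTurn_pow_four _) hc.bracket_ne_zero hc.norm_add (n + 1)

/-- A crossing of a row of twists is quasi-alternating. -/
theorem isQuasiAlternating_row {c : MarkedCrossing} (hc : c.IsQuasiAlternating) {n : ℕ}
    (hn : 1 ≤ n) (hdet : det c.smoothInfty < det c.smoothZero)
    (hq : QuasiAlternating (c.replace (c.horizontalOppositeTwists n))) {c' : MarkedCrossing}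
    (h : c.IsNewCrossing (c.horizontalOppositeTwists (n + 1)) c') :
    c'.IsQuasiAlternating ∧ c'.diagram = c.replace (c.horizontalOppositeTwists (n + 1)) := by
  obtain ⟨p, q, hT, hb, ha⟩ := h
  have hdiag : c'.diagram = c.replace (c.horizontalOppositeTwists (n + 1)) := by
    rw [hT, MarkedCrossing.diagram, replace, replace, hb, ha]
    simp
  rw [horizontalOppositeTwists, horizontalTwists_eq_row] at hT hdiag hq
  set s := !c.sign with hs
  obtain ⟨B₁, B₂, hB, hp, hq'⟩ := append_eq_append_of_notMem
    (fun h => by simp [cups] at h) (fun h => by simp at h) hT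
  obtain ⟨r, k, hrk, -, hj, h1, h2⟩ := columns_replicate_eq_append hB
  subst h1 h2
  have hrk' : r + k = n := by omega
  -- Changing one column does not affect the connecting minima and maxima, so both smoothings of
  -- `c'` are again rows.
  have middle : ∀ X : Column, c.replace (row (List.replicate r (.cross s) ++ X ::
      List.replicate k (.cross s)) c.pos) = c'.below ++ X.word c'.pos ++ c'.above := by
    intro X
    have e : (List.replicate r (Column.cross s) ++ X :: List.replicate k (.cross s)).length - 1 =
        (List.replicate (n + 1) (Column.cross s)).length - 1 := by
      simp only [List.length_append, List.length_cons, List.length_replicate]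
      omega
    rw [hb, ha, hp, hq', replace, row, e, columns_append, columns, List.length_replicate (n := r), ← hj]
    simp
  have hzero : DiagramEquiv c'.smoothZero c.smoothZero := by
    have := red_row_zero s r k c.pos c.below c.above (isLinkDiagram_row hc _)
    change DiagramEquiv (c.replace _) c.smoothZero at this
    rwa [middle .zero] at this
  have hinfty : DiagramEquiv c'.smoothInfty (c.replace (row (List.replicate n (.cross s)) c.pos)) := by
    have := red_row_infty s r k c.pos (by omega) c.below c.above (isLinkDiagram_row hc _)
    change DiagramEquiv (c.replace _) (c.replace _) at this
    rwa [middle .infty, hrk'] at this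
  have hd0 : det c'.smoothZero = det c.smoothZero := hzero.det_eq
  have hn1 : (1 : ℝ) ≤ n := by exact_mod_cast hn
  have hpos := hc.2.1.one_le_det
  have hd1 : det c'.smoothInfty = n * det c.smoothZero - det c.smoothInfty := by
    rw [hinfty.det_eq, hs, det_row hc hn, abs_of_nonneg]
    nlinarith
  have hd : det c'.diagram = (n + 1) * det c.smoothZero - det c.smoothInfty := by
    rw [hdiag, hs, det_row hc (by omega), abs_of_nonneg]
    · push_cast
      rfl
    · push_cast
      nlinarith
  have q0 : QuasiAlternating c'.smoothZero := .equiv _ _ (.symm _ _ hzero) hc.2.1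
  have q1 : QuasiAlternating c'.smoothInfty := .equiv _ _ (.symm _ _ hinfty) hq
  refine ⟨⟨?_, q0, q1, q0.one_le_det, q1.one_le_det, by rw [hd, hd0, hd1]; ring⟩, ?_⟩
  · rw [hdiag]
    exact isLinkDiagram_row hc _
  · rw [hdiag, horizontalOppositeTwists, horizontalTwists_eq_row]

/-- A row of one opposite crossing is again the switched diagram; the inductive step resolves the
leftmost crossing. -/
theorem quasiAlternating_row {c : MarkedCrossing} (hc : c.IsQuasiAlternating)
    (hI : c.PropertyI) (hdet : det c.smoothInfty < det c.smoothZero) {n : ℕ} (hn : 1 ≤ n) :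
    QuasiAlternating (c.replace (c.horizontalOppositeTwists n)) := by
  induction n, hn using Nat.le_induction with
  | base => exact hI
  | succ n hn ih =>
    have e : c.horizontalOppositeTwists (n + 1) = cups n (c.pos + 1) ++
        [cross (!c.sign) c.pos] ++ (columns (List.replicate n (.cross (!c.sign))) (c.pos + 2) ++
          List.replicate n (cap (c.pos + 1))) := by
      rw [horizontalOppositeTwists, horizontalTwists_eq_row, row, List.replicate_succ, columns]
      simp [Column.word]
    obtain ⟨h1, h2⟩ := isQuasiAlternating_row hc hn hdet ih
      (c' := ⟨c.below ++ cups n (c.pos + 1), !c.sign, c.pos, _ ++ c.above⟩)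
      ⟨_, _, e, rfl, rfl⟩
    exact h2 ▸ h1.diagram

end MarkedCrossing

end QALink

theorem mainTheorem5 (c : QALink.MarkedCrossing) (hc : c.IsQuasiAlternating)
    (hI : c.PropertyI) (n : ℕ) (hn : 1 < n) :
    (QALink.det c.smoothZero < QALink.det c.smoothInfty →
      QALink.QuasiAlternating (c.replace (c.verticalOppositeTwists n)) ∧
        ∀ c' : QALink.MarkedCrossing, c.IsNewCrossing (c.verticalOppositeTwists n) c' →
          c'.IsQuasiAlternating) ∧
    (QALink.det c.smoothInfty < QALink.det c.smoothZero →
      QALink.QuasiAlternating (c.replace (c.horizontalOppositeTwists n)) ∧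
        ∀ c' : QALink.MarkedCrossing, c.IsNewCrossing (c.horizontalOppositeTwists n) c' →
          c'.IsQuasiAlternating) := by
  -- The crossings of `n + 1` twists are controlled by the diagram with `n` twists, and `n ≥ 1` is
  -- what the sign of the determinant formula requires.
  obtain ⟨n, rfl⟩ := Nat.exists_eq_add_of_le' hn.le
  have hn' : 1 ≤ n := by omega
  constructor
  · intro h
    exact ⟨QALink.MarkedCrossing.quasiAlternating_stack hc hI h hn.le, fun c' h' =>
      (QALink.MarkedCrossing.isQuasiAlternating_stack hc hn' h
        (QALink.MarkedCrossing.quasiAlternating_stack hc hI h hn') h').1⟩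
  · intro h
    exact ⟨QALink.MarkedCrossing.quasiAlternating_row hc hI h hn.le, fun c' h' =>
      (QALink.MarkedCrossing.isQuasiAlternating_row hc hn' h
        (QALink.MarkedCrossing.quasiAlternating_row hc hI h hn') h').1⟩
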